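/- Let $\gamma\in\mathbb{R}$ be irrational and not a Liouville number, that is, there is $\eta\in\mathbb{N}$ with $\lVert q\gamma\rVert > q^{-\eta}$ for all integers $q\ge 2$, where $\lVert\cdot\rVert$ is the distance to the nearest integer. Let $\varepsilon>0$ and let $\psi:\{0,1,2,\dots\}\to[0,1/2]$ satisfy $$\sum_{q\ge 1} q\,\psi(q)=\infty,\qquad \psi(q)=O(q^{-\varepsilon})\quad (q\to\infty).$$ For $\boldsymbol\alpha=(\alpha_1,\alpha_2)\in\mathbb{T}^2=(\mathbb{R}/\mathbb{Z})^2$ and $Q\in\mathbb{N}$ let $$\mathcal{N}(\boldsymbol\alpha,Q,\gamma)=\#\left\{(p,(q_1,q_2))\in\mathbb{Z}\times\mathbb{Z}^2:\ |\boldsymbol q|\le Q,\ |q_1\alpha_1+q_2\alpha_2-p-\gamma|\le\psi(|\boldsymbol q|)\right\},\qquad |\boldsymbol q|=\max(|q_1|,|q_2|),$$ computed with any real representatives of $\alpha_1,\alpha_2$ (the number does not depend on the choice), and let $$\Psi(Q)=16\sum_{1\le q\le Q}q\,\psi(q)+8\sum_{1\le q\le Q}\psi(q).$$ Then for every $\delta>0$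 and Lebesgue-almost every $\boldsymbol\alpha\in\mathbb{T}^2$, $$\mathcal{N}(\boldsymbol\alpha,Q,\gamma)=\Psi(Q)+O\!\left(\Psi(Q)^{1/2}\,\bigl(\log\Psi(Q)\bigr)^{3/2+\delta}\right),\qquad Q\to\infty,$$ where the implied constant may depend on $\boldsymbol\alpha,\gamma,\psi,\delta$. -/

import Mathlib

open Filter Asymptotics MeasureTheory

/-- The maximum norm `max (|q₁|, |q₂|)` of an integer vector. -/
def supNorm (q : Fin 2 → ℤ) : ℕ := max (q 0).natAbs (q 1).natAbs

/-- The pairs `(p, q) ∈ ℤ × ℤ²` with `|q| ≤ Q` and `|q · a - p - γ| ≤ ψ(|q|)`. Translating `a` by an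
integer vector only permutes the integers `p` that occur for each `q`. -/
def goodApprox (ψ : ℕ → ℝ) (γ : ℝ) (a : Fin 2 → ℝ) (Q : ℕ) : Set (ℤ × (Fin 2 → ℤ)) :=
  {x | supNorm x.2 ≤ Q ∧
    |(x.2 0 : ℝ) * a 0 + (x.2 1 : ℝ) * a 1 - (x.1 : ℝ) - γ| ≤ ψ (supNorm x.2)}

/-- The set of good approximations up to a given height is finite, so that its `Set.ncard` is its
true number of elements. -/
theorem goodApprox_finite (ψ : ℕ → ℝ) (γ : ℝ) (a : Fin 2 → ℝ) (Q : ℕ) :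
    (goodApprox ψ γ a Q).Finite := by
  have hq : (Set.Icc (fun _ : Fin 2 => -(Q : ℤ)) (fun _ => (Q : ℤ))).Finite := Set.finite_Icc _ _
  refine (hq.biUnion (t := fun q => (fun p : ℤ => (p, q)) ''
    (Set.Icc ⌊(q 0 : ℝ) * a 0 + (q 1 : ℝ) * a 1 - γ - ψ (supNorm q)⌋
      ⌈(q 0 : ℝ) * a 0 + (q 1 : ℝ) * a 1 - γ + ψ (supNorm q)⌉))
    fun q _ => (Set.finite_Icc _ _).image _).subset ?_
  rintro ⟨p, q⟩ ⟨h1, h2⟩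
  simp only [supNorm] at h1
  rw [abs_le] at h2
  simp only [Set.mem_iUnion, Set.mem_image, Prod.mk.injEq, exists_prop]
  refine ⟨q, ⟨?_, ?_⟩, p, ⟨?_, ?_⟩, rfl, rfl⟩
  · intro i; fin_cases i <;> simp <;> omega
  · intro i; fin_cases i <;> simp <;> omega
  · have := Int.floor_le ((q 0 : ℝ) * a 0 + (q 1 : ℝ) * a 1 - γ - ψ (supNorm q))
    have h3 := h2.2
    simp only at h3
    have h4 := this.trans (show _ ≤ (p : ℝ) by linarith)
    exact_mod_cast h4
  · have := Int.le_ceil ((q 0 : ℝ) * a 0 + (q 1 : ℝ) * a 1 - γ + ψ (supNorm q))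
    have h3 := h2.1
    simp only at h3
    have h4 := le_trans (show (p : ℝ) ≤ _ by linarith) this
    exact_mod_cast h4

/-- The counting function `N(a, Q, γ)`. -/
noncomputable def countN (ψ : ℕ → ℝ) (γ : ℝ) (a : Fin 2 → ℝ) (Q : ℕ) : ℕ :=
  (goodApprox ψ γ a Q).ncard

/-- The main term `16 ∑_{1 ≤ q ≤ Q} q ψ(q) + 8 ∑_{1 ≤ q ≤ Q} ψ(q)`. -/
noncomputable def mainTerm (ψ : ℕ → ℝ) (Q : ℕ) : ℝ :=
  16 * ∑ q ∈ Finset.Icc 1 Q, (q : ℝ) * ψ q + 8 * ∑ q ∈ Finset.Icc 1 Q, ψ q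

/-! For `q ≠ 0` the set of `α` with `‖q · α - γ‖ ≤ ψ(|q|)` has measure `2ψ(|q|)`, and there are `8h`
vectors of norm `h`. The expected count over `0 < |q| ≤ Q` is therefore `16 ∑ hψ(h)`. Everything
rests on a variance bound of the same order: over `m < |q| ≤ n` the variance is `O(∑ hψ(h))`
(`exists_variance_shell_le`).

Two non-parallel frequencies give independent events, because the pair of characters maps Haar
measure to Haar measure (`measurePreserving_torusChar_prod`). Parallel frequencies are `q = a w`,
`q' = b w` with `a`, `b` coprime and, say, `|a| ≤ b`. Their covariance is at most `2ψ(|q'|)/b`, so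
each `b` contributes `O(ψ(|q'|))` after summing over `a`. Admitting every divisor `b` would cost too
much, and here the hypothesis on `γ` enters: a common point of the two sets makes `‖(a - b)γ‖` at
most `bψ(|q|) + |a|ψ(|q'|)`. As `γ` is not Liouville and `ψ` decays like a power, this forces `b` to
exceed a power of `|q'|` unless `b = 1` (`rpow_le_of_nonempty_inter`). Only about `8h/b` vectors of
norm `h` are divisible by `b`, so the divisor bound leaves `O(h)` admissible pairs `(q', b)` with
`|q'| = h` (`exists_sum_card_denomSet_le`).

A Rademacher–Menshov maximal inequality and monotonicity of the count turn the variance bound into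
the almost sure asymptotic (`ae_isBigO_of_variance_le`). The frequency zero contributes a constant,
and the term `8 ∑ ψ` is absorbed by the error since `(∑ ψ)² ≤ ∑ qψ(q)`. -/

/-! ### Arithmetic inputs: divisor bound and Diophantine exponent. -/

/-- The divisor bound: `d(n) ≪ n ^ s` for every `s > 0`. -/
theorem card_divisors_le_rpow {s : ℝ} (hs : 0 < s) :
    ∃ C : ℝ, 0 < C ∧ ∀ n : ℕ, n ≠ 0 → (n.divisors.card : ℝ) ≤ C * (n : ℝ) ^ s := by
  set K : ℝ := max 1 (1 / (s * Real.log 2)) with hK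
  have hK1 : 1 ≤ K := le_max_left _ _
  have hlog : 0 < s * Real.log 2 := mul_pos hs (Real.log_pos (by norm_num))
  have hK2 : 1 ≤ K * (s * Real.log 2) := by
    have : 1 / (s * Real.log 2) ≤ K := le_max_right _ _
    rwa [div_le_iff₀ hlog] at this
  obtain ⟨P, hP⟩ : ∃ P : ℕ, (2 : ℝ) ^ (1 / s) ≤ P := exists_nat_ge _
  -- Once `p ≥ P` one has `p ^ s ≥ 2`, and `f + 1 ≤ 2 ^ f` suffices. The factor `K` is lost only at
  -- the primes below `P`, at most `P` times in all.
  have key : ∀ p : ℕ, 2 ≤ p → ∀ f : ℕ,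
      ((f : ℝ) + 1) ≤ (if p < P then K else 1) * ((p : ℝ) ^ s) ^ f := by
    intro p hp f
    have hp2 : (2 : ℝ) ≤ p := by exact_mod_cast hp
    split_ifs with h
    · have h1 : ((2 : ℝ) ^ s) ^ f ≤ ((p : ℝ) ^ s) ^ f := by gcongr
      have h2 : 1 + (f : ℝ) * (s * Real.log 2) ≤ ((2 : ℝ) ^ s) ^ f := by
        rw [Real.rpow_def_of_pos (by norm_num), ← Real.exp_nat_mul]
        have := Real.add_one_le_exp ((f : ℝ) * (Real.log 2 * s))
        linarith
      calc (f : ℝ) + 1 ≤ K * (1 + (f : ℝ) * (s * Real.log 2)) := by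
            nlinarith [(Nat.cast_nonneg f : (0 : ℝ) ≤ f)]
        _ ≤ _ := by gcongr; exact h2.trans h1
    · have h0 : (2 : ℝ) ≤ (p : ℝ) ^ s := by
        have h1 : (2 : ℝ) ^ (1 / s) ≤ p := hP.trans (by exact_mod_cast not_lt.mp h)
        calc (2 : ℝ) = ((2 : ℝ) ^ (1 / s)) ^ s := by
              rw [← Real.rpow_mul (by norm_num), one_div_mul_cancel hs.ne', Real.rpow_one]
          _ ≤ _ := by gcongr
      rw [one_mul]
      have h3 : ((f : ℝ) + 1) ≤ 2 ^ f := by exact_mod_cast Nat.lt_two_pow_self (n := f)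
      exact h3.trans (by gcongr)
  refine ⟨K ^ P, by positivity, fun n hn => ?_⟩
  rw [Nat.card_divisors hn]
  push_cast
  have hprod : (n : ℝ) ^ s = ∏ p ∈ n.primeFactors, ((p : ℝ) ^ s) ^ (n.factorization p) := by
    conv_lhs => rw [← Nat.prod_factorization_pow_eq_self hn]
    rw [Finsupp.prod, Nat.support_factorization]
    push_cast
    rw [← Real.finsetProd_rpow _ _ (fun i _ => by positivity)]
    refine Finset.prod_congr rfl fun p _ => ?_
    rw [← Real.rpow_natCast, ← Real.rpow_natCast, ← Real.rpow_mul (by positivity),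
      ← Real.rpow_mul (by positivity), mul_comm]
  calc ∏ p ∈ n.primeFactors, ((n.factorization p : ℝ) + 1)
      ≤ ∏ p ∈ n.primeFactors, ((if p < P then K else 1) * ((p : ℝ) ^ s) ^ n.factorization p) :=
        Finset.prod_le_prod (fun _ _ => by positivity)
          fun p hp => key p (Nat.prime_of_mem_primeFactors hp).two_le _
    _ = (∏ p ∈ n.primeFactors, (if p < P then K else 1)) * (n : ℝ) ^ s := by
        rw [Finset.prod_mul_distrib, hprod]
    _ ≤ _ := by
        gcongr
        rw [Finset.prod_ite, Finset.prod_const, Finset.prod_const_one, mul_one]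
        refine pow_le_pow_right₀ hK1 ?_
        calc _ ≤ (Finset.range P).card := Finset.card_le_card fun p hp => by
              simpa using (Finset.mem_filter.mp hp).2
          _ = P := Finset.card_range P

/-- The lower bound for `‖kγ‖` at an irrational number that is not Liouville. -/
theorem exists_le_abs_mul_sub_of_not_liouville {γ : ℝ} (hγ : Irrational γ) (hL : ¬ Liouville γ) :
    ∃ n : ℕ, ∀ k : ℤ, k ≠ 0 → ∀ a : ℤ, 1 / (2 * |(k : ℝ)|) ^ n ≤ |(k : ℝ) * γ - a| := by
  unfold Liouville at hL
  push Not at hL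
  obtain ⟨n, hn⟩ := hL
  refine ⟨n, ?_⟩
  have pos : ∀ k : ℤ, 0 < k → ∀ a : ℤ, 1 / (2 * |(k : ℝ)|) ^ n ≤ |(k : ℝ) * γ - a| := by
    intro k hk a
    have hk1 : (1 : ℝ) ≤ k := by exact_mod_cast hk
    -- The definition of `Liouville` only sees denominators above 1; doubling the fraction admits `k
    -- = 1`.
    have h := hn (2 * a) (2 * k) (by omega) (by
      have := hγ.ne_rat ((2 * a : ℤ) / (2 * k : ℤ) : ℚ)
      exact_mod_cast this)
    push_cast at h
    rw [abs_of_pos (by positivity)]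
    have e : γ - 2 * (a : ℝ) / (2 * k) = (k * γ - a) / k := by field_simp
    rw [e, abs_div, abs_of_pos (by positivity : (0 : ℝ) < k)] at h
    exact h.trans (div_le_self (abs_nonneg _) hk1)
  intro k hk a
  rcases lt_or_gt_of_ne hk with h | h
  · have := pos (-k) (by omega) (-a)
    push_cast at this
    rw [abs_neg] at this
    rwa [show -(k : ℝ) * γ - -(a : ℝ) = -((k : ℝ) * γ - a) by ring, abs_neg] at this
  · exact pos k h a

/-! ### Dyadic chaining. -/

/-- The sum of the squares of the increments of `g` over the dyadic intervals in `[0, 2 ^ m]`. -/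
def dyadicSq : ℕ → (ℕ → ℝ) → ℝ
  | 0, g => (g 1 - g 0) ^ 2
  | m + 1, g => dyadicSq m (fun i => g (2 * i)) +
      ∑ i ∈ Finset.range (2 ^ (m + 1)), (g (i + 1) - g i) ^ 2

theorem dyadicSq_nonneg (m : ℕ) (g : ℕ → ℝ) : 0 ≤ dyadicSq m g := by
  induction m generalizing g with
  | zero => exact sq_nonneg _
  | succ m ih => exact add_nonneg (ih _) (Finset.sum_nonneg fun _ _ => sq_nonneg _)

/-- The binary expansion of `j` joins `0` to `j` by at most one dyadic interval from each of `m + 1`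
levels; Cauchy–Schwarz gives the factor `m + 1`. -/
theorem sq_le_dyadicSq (m : ℕ) (g : ℕ → ℝ) (j : ℕ) (hj : j ≤ 2 ^ m) :
    (g j - g 0) ^ 2 ≤ (m + 1) * dyadicSq m g := by
  induction m generalizing g j with
  | zero =>
    have : j = 0 ∨ j = 1 := by simp at hj; omega
    rcases this with rfl | rfl <;> simp [dyadicSq, sq_nonneg]
  | succ m ih =>
    have h1 := ih (fun i => g (2 * i)) (j / 2) (by rw [pow_succ] at hj; omega)
    simp only [mul_zero] at h1
    have h2 : (g j - g (2 * (j / 2))) ^ 2 ≤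
        ∑ i ∈ Finset.range (2 ^ (m + 1)), (g (i + 1) - g i) ^ 2 := by
      rcases Nat.even_or_odd' j with ⟨k, rfl | rfl⟩
      · rw [Nat.mul_div_cancel_left _ (by norm_num), sub_self]
        simpa using Finset.sum_nonneg fun i (_ : i ∈ Finset.range (2 ^ (m + 1))) =>
          sq_nonneg (g (i + 1) - g i)
      · rw [show (2 * k + 1) / 2 = k by omega]
        exact Finset.single_le_sum (f := fun i => (g (i + 1) - g i) ^ 2)
          (fun i _ => sq_nonneg _) (Finset.mem_range.mpr (by omega : 2 * k < 2 ^ (m + 1)))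
    simp only [dyadicSq]
    push_cast
    set A := g (2 * (j / 2)) - g 0
    set B := g j - g (2 * (j / 2))
    set D := dyadicSq m fun i => g (2 * i)
    have e : g j - g 0 = A + B := by simp only [A, B]; ring
    rw [e]
    have hm : (0 : ℝ) < m + 1 := by positivity
    -- Cauchy–Schwarz with weights `m + 1` and `1`, chosen so that the constant grows only from `m +
    -- 1` to `m + 2`.
    have h3 : (m + 1 : ℝ) * (A + B) ^ 2 ≤ (m + 2) * (A ^ 2 + (m + 1) * B ^ 2) := by
      nlinarith [sq_nonneg (A - (m + 1) * B)]
    have h4 : (m + 2 : ℝ) * (A ^ 2 + (m + 1) * B ^ 2) ≤ (m + 1) * ((m + 2) *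
        (D + ∑ i ∈ Finset.range (2 ^ (m + 1)), (g (i + 1) - g i) ^ 2)) := by
      have : A ^ 2 + (m + 1) * B ^ 2 ≤ (m + 1) *
        (D + ∑ i ∈ Finset.range (2 ^ (m + 1)), (g (i + 1) - g i) ^ 2) := by nlinarith
      nlinarith
    have h5 := le_of_mul_le_mul_left (h3.trans h4) hm
    linarith

/-! ### Maximal inequality and Gál–Koksma lemma. -/

section Abstract

variable {Ω : Type*} [MeasurableSpace Ω] {μ : Measure Ω}

theorem integrable_dyadicSq {R : ℕ → Ω → ℝ} (hR : ∀ n, MemLp (R n) 2 μ) (m : ℕ) (p : ℕ → ℕ) :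
    Integrable (fun ω => dyadicSq m fun i => R (p i) ω) μ := by
  induction m generalizing p with
  | zero => exact ((hR _).sub (hR _)).integrable_sq
  | succ m ih =>
    exact (ih fun i => p (2 * i)).add
      (integrable_finsetSum _ fun i _ => ((hR _).sub (hR _)).integrable_sq)

/-- On each of the `m + 1` levels the bounds for the increments telescope to the same total. -/
theorem integral_dyadicSq_le {R : ℕ → Ω → ℝ} (hR : ∀ n, MemLp (R n) 2 μ) {Φ : ℕ → ℝ}
    (hvar : ∀ m n, m ≤ n → ∫ ω, (R n ω - R m ω) ^ 2 ∂μ ≤ Φ n - Φ m) (m : ℕ) {p : ℕ → ℕ}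
    (hp : Monotone p) :
    ∫ ω, dyadicSq m (fun i => R (p i) ω) ∂μ ≤ (m + 1) * (Φ (p (2 ^ m)) - Φ (p 0)) := by
  induction m generalizing p with
  | zero => simpa [dyadicSq] using hvar _ _ (hp zero_le_one)
  | succ m ih =>
    have h1 := ih (p := fun i => p (2 * i)) fun a b h => hp (by omega)
    have hI : ∀ i, Integrable (fun ω => (R (p (i + 1)) ω - R (p i) ω) ^ 2) μ := fun i =>
      ((hR _).sub (hR _)).integrable_sq
    simp only [dyadicSq]
    rw [integral_add (integrable_dyadicSq hR m fun i => p (2 * i))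
      (integrable_finsetSum _ fun i _ => hI i), integral_finsetSum _ fun i _ => hI i]
    have h2 : ∑ i ∈ Finset.range (2 ^ (m + 1)), ∫ ω, (R (p (i + 1)) ω - R (p i) ω) ^ 2 ∂μ ≤
        Φ (p (2 ^ (m + 1))) - Φ (p 0) := by
      rw [← Finset.sum_range_sub (fun i => Φ (p i))]
      exact Finset.sum_le_sum fun i _ => hvar _ _ (hp i.le_succ)
    simp only [mul_zero, ← pow_succ'] at h1
    push_cast
    linarith

/-- A maximal inequality of Rademacher–Menshov type, almost surely along all dyadic scales. -/
theorem ae_exists_forall_abs_le {R : ℕ → Ω → ℝ} (hR : ∀ n, MemLp (R n) 2 μ) (hR0 : ∀ ω, R 0 ω = 0)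
    {Φ : ℕ → ℝ} (hΦ0 : 0 ≤ Φ 0)
    (hvar : ∀ m n, m ≤ n → ∫ ω, (R n ω - R m ω) ^ 2 ∂μ ≤ Φ n - Φ m) {p : ℕ → ℕ → ℕ}
    (hp : ∀ r, Monotone (p r)) (hp0 : ∀ r, p r 0 = 0) (hpΦ : ∀ r, Φ (p r (2 ^ r)) ≤ 2 ^ r)
    {δ : ℝ} (hδ : 0 < δ) :
    ∀ᵐ ω ∂μ, ∃ C : ℝ, 0 ≤ C ∧ ∀ r j : ℕ, j ≤ 2 ^ r →
      |R (p r j) ω| ≤ C * ((2 : ℝ) ^ r) ^ (1 / 2 : ℝ) * ((r : ℝ) + 1) ^ (3 / 2 + δ) := by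
  -- The mean square at scale `r` is at most `(r + 1) 2 ^ r`. Dividing by this weight leaves the
  -- summable `(r + 1) ^ (-(1 + 2δ))`, so the normalised sums are almost surely bounded in `r`.
  set w : ℕ → ℝ := fun r => (2 : ℝ) ^ r * ((r : ℝ) + 1) ^ (2 + 2 * δ) with hw
  have hwpos : ∀ r, 0 < w r := fun r => by positivity
  set F : ℕ → Ω → ℝ := fun r ω => dyadicSq r (fun i => R (p r i) ω) / w r with hF
  have hFnn : ∀ r ω, 0 ≤ F r ω := fun r ω => div_nonneg (dyadicSq_nonneg _ _) (hwpos r).le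
  have hFint : ∀ r, Integrable (F r) μ := fun r => (integrable_dyadicSq hR r (p r)).div_const _
  have hE : ∀ r, ∫ ω, F r ω ∂μ ≤ 1 / ((r : ℝ) + 1) ^ (1 + 2 * δ) := by
    intro r
    simp only [hF]
    rw [integral_div, div_le_div_iff₀ (hwpos r) (by positivity), one_mul]
    have h1 := integral_dyadicSq_le hR hvar r (hp r)
    have h2 : ((r : ℝ) + 1) * (Φ (p r (2 ^ r)) - Φ (p r 0)) ≤ (r + 1) * 2 ^ r := by
      rw [hp0]
      have := hpΦ r
      gcongr
      linarith
    have h3 : w r = (r + 1) * 2 ^ r * ((r : ℝ) + 1) ^ (1 + 2 * δ) := by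
      simp only [hw]
      rw [show 2 + 2 * δ = 1 + (1 + 2 * δ) by ring, Real.rpow_add (by positivity), Real.rpow_one]
      ring
    rw [h3]
    gcongr
    exact h1.trans h2
  have hsum : Summable fun r : ℕ => 1 / ((r : ℝ) + 1) ^ (1 + 2 * δ) := by
    have := (summable_nat_add_iff 1).mpr
      (Real.summable_one_div_nat_rpow (p := 1 + 2 * δ).mpr (by linarith))
    simpa using this
  have hlin : ∫⁻ ω, ∑' r, ENNReal.ofReal (F r ω) ∂μ ≠ ⊤ := by
    rw [lintegral_tsum fun r => (hFint r).aestronglyMeasurable.aemeasurable.ennreal_ofReal]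
    have : ∀ r, ∫⁻ ω, ENNReal.ofReal (F r ω) ∂μ ≤
        ENNReal.ofReal (1 / ((r : ℝ) + 1) ^ (1 + 2 * δ)) := fun r => by
      rw [← ofReal_integral_eq_lintegral_ofReal (hFint r) (Eventually.of_forall (hFnn r))]
      exact ENNReal.ofReal_le_ofReal (hE r)
    refine ne_top_of_le_ne_top ?_ (ENNReal.tsum_le_tsum this)
    exact hsum.tsum_ofReal_ne_top
  filter_upwards [ae_lt_top' (AEMeasurable.tsum fun r =>
    (hFint r).aestronglyMeasurable.aemeasurable.ennreal_ofReal) hlin] with ω hω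
  set C := (∑' r, ENNReal.ofReal (F r ω)).toReal with hC
  have hFC : ∀ r, F r ω ≤ C := fun r => by
    have := ENNReal.toReal_mono hω.ne (ENNReal.le_tsum (f := fun r => ENNReal.ofReal (F r ω)) r)
    rwa [ENNReal.toReal_ofReal (hFnn r ω)] at this
  have hC0 : 0 ≤ C := ENNReal.toReal_nonneg
  refine ⟨Real.sqrt C, Real.sqrt_nonneg _, fun r j hj => ?_⟩
  refine abs_le_of_sq_le_sq ?_ (by positivity)
  have h1 := sq_le_dyadicSq r (fun i => R (p r i) ω) j hj
  simp only [hp0, hR0, sub_zero] at h1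
  have h2 : dyadicSq r (fun i => R (p r i) ω) ≤ C * w r := (div_le_iff₀ (hwpos r)).mp (hFC r)
  have e1 : (((2 : ℝ) ^ r) ^ (1 / 2 : ℝ)) ^ 2 = 2 ^ r := by
    rw [← Real.sqrt_eq_rpow, Real.sq_sqrt (by positivity)]
  have e2 : (((r : ℝ) + 1) ^ (3 / 2 + δ)) ^ 2 = (r + 1) * ((r : ℝ) + 1) ^ (2 + 2 * δ) := by
    rw [← Real.rpow_natCast, ← Real.rpow_mul (by positivity),
      show (3 / 2 + δ) * ((2 : ℕ) : ℝ) = 1 + (2 + 2 * δ) by push_cast; ring,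
      Real.rpow_add (by positivity), Real.rpow_one]
  rw [mul_pow, mul_pow, Real.sq_sqrt hC0, e1, e2]
  calc _ ≤ _ := h1
    _ ≤ (r + 1) * (C * w r) := by gcongr
    _ = _ := by simp only [hw]; ring

/-- The quantitative Borel–Cantelli lemma in the form of Gál and Koksma: a nondecreasing counting
function whose deviation from `c Φ` has quasi-orthogonal increments. -/
theorem ae_isBigO_of_variance_le {S : ℕ → Ω → ℝ} (hS : ∀ n, MemLp (S n) 2 μ)
    [IsFiniteMeasure μ] (hS0 : ∀ ω, S 0 ω = 0) (hSmono : ∀ ω, Monotone fun n => S n ω)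
    {Φ : ℕ → ℝ} (hΦ : Monotone Φ) (hΦ0 : Φ 0 = 0) (hΦlim : Tendsto Φ atTop atTop)
    {c : ℝ} (hc0 : 0 ≤ c) (hc1 : c ≤ 1)
    (hvar : ∀ m n, m ≤ n →
      ∫ ω, (S n ω - c * Φ n - (S m ω - c * Φ m)) ^ 2 ∂μ ≤ Φ n - Φ m)
    {δ : ℝ} (hδ : 0 < δ) :
    ∀ᵐ ω ∂μ, (fun n => S n ω - c * Φ n) =O[atTop]
      fun n => Φ n ^ (1 / 2 : ℝ) * Real.log (Φ n) ^ (3 / 2 + δ) := by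
  classical
  have hex : ∀ j : ℕ, ∃ n, (j : ℝ) ≤ Φ n := fun j => (hΦlim.eventually_ge_atTop _).exists
  -- First time at which `Φ` reaches level `j`. The value `Φ (l j)` may overshoot `j`, but `Φ (l j -
  -- 1) < j`.
  set l : ℕ → ℕ := fun j => Nat.find (hex j) with hl
  have hlspec : ∀ j : ℕ, (j : ℝ) ≤ Φ (l j) := fun j => Nat.find_spec (hex j)
  have hlle : ∀ j n : ℕ, (j : ℝ) ≤ Φ n → l j ≤ n := fun j n h => Nat.find_min' (hex j) h
  have hllt : ∀ j n, n < l j → Φ n < j := fun j n h => not_le.mp (Nat.find_min (hex j) h)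
  have hl0 : l 0 = 0 := Nat.le_zero.mp (hlle 0 0 (by simp [hΦ0]))
  have hlmono : Monotone l := fun a b h => hlle a _ (le_trans (by exact_mod_cast h) (hlspec b))
  have hlpos : ∀ j, 1 ≤ j → 1 ≤ l j := fun j hj => by
    by_contra h
    have h0 : l j = 0 := by omega
    have := hlspec j
    rw [h0, hΦ0] at this
    have : (1 : ℝ) ≤ j := by exact_mod_cast hj
    linarith
  have hu : ∀ r : ℕ, Φ (l (2 ^ r) - 1) ≤ 2 ^ r := fun r => by
    have := hllt (2 ^ r) (l (2 ^ r) - 1) (by have := hlpos (2 ^ r) Nat.one_le_two_pow; omega)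
    push_cast at this
    exact this.le
  have hRL : ∀ n, MemLp (fun ω => S n ω - c * Φ n) 2 μ := fun n => (hS n).sub (memLp_const _)
  have hR0 : ∀ ω, S 0 ω - c * Φ 0 = 0 := fun ω => by rw [hS0, hΦ0]; ring
  -- Two grids bracket `N`: the points `l j - 1` serve the upper bound, the points `l j` the lower
  -- one. Truncating the second grid at `l (2 ^ r) - 1` keeps its last value of `Φ` below `2 ^ r`;
  -- the truncation is inactive at the point used below.
  have A := ae_exists_forall_abs_le hRL hR0 hΦ0.ge hvar (p := fun _ j => l j - 1)
    (fun _ a b h => Nat.sub_le_sub_right (hlmono h) 1) (fun _ => by simp [hl0]) hu hδ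
  have B := ae_exists_forall_abs_le hRL hR0 hΦ0.ge hvar (p := fun r j => min (l j) (l (2 ^ r) - 1))
    (fun r a b h => min_le_min_right _ (hlmono h)) (fun _ => by simp [hl0])
    (fun r => (hΦ (Nat.min_le_right _ _)).trans (hu r)) hδ
  filter_upwards [A, B] with ω ⟨C₁, hC₁, h₁⟩ ⟨C₂, hC₂, h₂⟩
  have hlog2 : (1 / 2 : ℝ) ≤ Real.log 2 := by have := Real.log_two_gt_d9; linarith
  have hlog2' : Real.log 2 ≤ 0.7 := by have := Real.log_two_lt_d9; linarith
  -- The constants 4 and 6 are those of `hr2` and `hrlog`; the final 1 pays for the change of `c Φ`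
  -- between `N` and its grid neighbours.
  refine IsBigO.of_bound ((C₁ + C₂) * ((4 : ℝ) ^ (1 / 2 : ℝ) * 6 ^ (3 / 2 + δ)) + 1) ?_
  filter_upwards [hΦlim.eventually_ge_atTop (Real.exp 1)] with N hN
  have hN1 : (1 : ℝ) ≤ Φ N := (Real.one_le_exp zero_le_one).trans hN
  have hlogN : 1 ≤ Real.log (Φ N) := (Real.le_log_iff_exp_le (by linarith)).mpr hN
  set j := ⌊Φ N⌋₊ with hj
  have hjle : (j : ℝ) ≤ Φ N := Nat.floor_le (by linarith)
  have hjlt : Φ N < j + 1 := Nat.lt_floor_add_one _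
  have hj1 : 1 ≤ j := Nat.one_le_floor_iff _ |>.mpr hN1
  set r := Nat.clog 2 (j + 1) with hr
  have hjr : j + 1 ≤ 2 ^ r := Nat.le_pow_clog (by norm_num) _
  have hr2 : (2 : ℝ) ^ r ≤ 4 * Φ N := by
    have h1 : 2 ^ (r - 1) < j + 1 := Nat.pow_pred_clog_lt_self (by norm_num) (by omega)
    have h2 : 1 ≤ r := Nat.clog_pos (by norm_num) (by omega)
    have h3 : 2 ^ r = 2 * 2 ^ (r - 1) := by rw [← pow_succ']; congr 1; omega
    have h4 : 2 ^ r ≤ 4 * j := by omega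
    calc (2 : ℝ) ^ r ≤ 4 * j := by exact_mod_cast h4
      _ ≤ _ := by linarith
  have hrlog : (r : ℝ) + 1 ≤ 6 * Real.log (Φ N) := by
    have h1 := Real.log_le_log (by positivity) hr2
    rw [Real.log_pow, Real.log_mul (by norm_num) (by linarith),
      show (4 : ℝ) = 2 ^ 2 by norm_num, Real.log_pow] at h1
    push_cast at h1
    have : (0 : ℝ) ≤ r := by positivity
    nlinarith
  set E := ((2 : ℝ) ^ r) ^ (1 / 2 : ℝ) * ((r : ℝ) + 1) ^ (3 / 2 + δ) with hE
  set G := Φ N ^ (1 / 2 : ℝ) * Real.log (Φ N) ^ (3 / 2 + δ) with hG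
  have hEG : E ≤ ((4 : ℝ) ^ (1 / 2 : ℝ) * 6 ^ (3 / 2 + δ)) * G := by
    calc E ≤ (4 * Φ N) ^ (1 / 2 : ℝ) * (6 * Real.log (Φ N)) ^ (3 / 2 + δ) := by
          simp only [hE]; gcongr
      _ = _ := by
          rw [Real.mul_rpow (by norm_num) (by linarith), Real.mul_rpow (by norm_num) (by linarith)]
          simp only [hG]; ring
  have hG1 : 1 ≤ G := by
    have h1 := Real.one_le_rpow hN1 (show (0 : ℝ) ≤ 1 / 2 by norm_num)
    have h2 := Real.one_le_rpow hlogN (show (0 : ℝ) ≤ 3 / 2 + δ by positivity)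
    simp only [hG]
    nlinarith
  have hlN : l j ≤ N := hlle _ _ hjle
  have hNl : N < l (j + 1) := by
    by_contra h
    have := (hlspec (j + 1)).trans (hΦ (not_lt.mp h))
    push_cast at this
    linarith
  have hNl' : N ≤ l (2 ^ r) - 1 := by have := hlmono hjr; omega
  have hup := h₁ r (j + 1) hjr
  have hlow := h₂ r j (by omega)
  beta_reduce at hup hlow
  rw [min_eq_left (hlN.trans hNl')] at hlow
  rw [mul_assoc, ← hE] at hup hlow
  rw [abs_le] at hup hlow
  -- With `l j ≤ N ≤ l (j + 1) - 1`, monotonicity traps `S N` between its grid values, while `Φ`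
  -- varies by less than 1 across this range.
  have m1 := hSmono ω hlN
  have m2 := hSmono ω (show N ≤ l (j + 1) - 1 by omega)
  have m3 := hllt (j + 1) (l (j + 1) - 1) (by omega)
  have m4 := hlspec j
  have m5 := hΦ (show N ≤ l (j + 1) - 1 by omega)
  push_cast at m3
  beta_reduce at m1 m2
  have hEnn : 0 ≤ E := by positivity
  rw [Real.norm_eq_abs, Real.norm_of_nonneg (by linarith)]
  have hfin : |S N ω - c * Φ N| ≤ (C₁ + C₂) * E + 1 := by
    rw [abs_le]
    constructor <;> nlinarith [mul_nonneg hC₁ hEnn, mul_nonneg hC₂ hEnn]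
  refine hfin.trans ?_
  have : (C₁ + C₂) * E ≤ (C₁ + C₂) * (((4 : ℝ) ^ (1 / 2 : ℝ) * 6 ^ (3 / 2 + δ)) * G) := by gcongr
  linarith

end Abstract

/-! ### Resonant sets on the circle and the torus. -/

section Torus

instance UnitAddCircle.isProbabilityMeasure_volume :
    IsProbabilityMeasure (volume : Measure UnitAddCircle) :=
  ⟨by rw [AddCircle.measure_univ, ENNReal.ofReal_one]⟩

theorem UnitAddCircle.norm_coe_le_iff {x r : ℝ} :
    ‖(x : UnitAddCircle)‖ ≤ r ↔ ∃ n : ℤ, |x - n| ≤ r := by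
  rw [UnitAddCircle.norm_eq]
  exact ⟨fun h => ⟨_, h⟩, fun ⟨n, h⟩ => (round_le x n).trans h⟩

theorem UnitAddCircle.coe_intCast (n : ℤ) : ((n : ℝ) : UnitAddCircle) = 0 := by
  rw [AddCircle.coe_eq_zero_iff]
  exact ⟨n, by simp⟩

theorem measureReal_circle_closedBall (x : UnitAddCircle) {r : ℝ} (h0 : 0 ≤ r) (h1 : r ≤ 1 / 2) :
    volume.real (Metric.closedBall x r) = 2 * r := by
  rw [Measure.real, AddCircle.volume_closedBall, min_eq_right (by linarith),
    ENNReal.toReal_ofReal (by linarith)]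

/-- The number of multiples `j / b` whose translate by `y` is within `r` of the origin. -/
theorem card_filter_norm_add_le (y : UnitAddCircle) {a : ℤ} {b : ℕ} (hb : 0 < b)
    (hab : IsCoprime a (b : ℤ)) {r : ℝ} (hr : 0 ≤ r) :
    (((Finset.range b).filter fun j : ℕ =>
      ‖y + a • (((j : ℝ) / b : ℝ) : UnitAddCircle)‖ ≤ r).card : ℝ) ≤ 2 * r * b + 1 := by
  classical
  obtain ⟨y, rfl⟩ := QuotientAddGroup.mk_surjective y
  have hb' : (0 : ℝ) < b := by exact_mod_cast hb
  set s := (Finset.range b).filter fun j : ℕ =>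
      ‖((y : ℝ) : UnitAddCircle) + a • (((j : ℝ) / b : ℝ) : UnitAddCircle)‖ ≤ r with hs
  have hex : ∀ j ∈ s, ∃ n : ℤ, |y + a * ((j : ℝ) / b) - n| ≤ r := fun j hj => by
    have := (Finset.mem_filter.mp hj).2
    rwa [← AddCircle.coe_zsmul, ← AddCircle.coe_add, UnitAddCircle.norm_coe_le_iff,
      zsmul_eq_mul] at this
  choose! n hn using hex
  have hcard : s.card ≤ (Finset.Icc ⌈-(y * b) - r * b⌉ ⌊-(y * b) + r * b⌋).card := by
    -- After scaling by `b`, each counted `j` yields an integer in an interval of length `2rb`. That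
    -- integer is `a j` modulo `b`, and it determines `j < b` because `a` is invertible modulo `b`.
    refine Finset.card_le_card_of_injOn (fun j => a * (j : ℤ) - n j * b) ?_ ?_
    · intro j hj
      have h := hn j hj
      have e : y + a * ((j : ℝ) / b) - n j = (y * b + (a * j - n j * b)) / b := by field_simp; ring
      rw [e, abs_div, abs_of_pos hb', div_le_iff₀ hb', abs_le] at h
      rw [Finset.coe_Icc, Set.mem_Icc, Int.ceil_le, Int.le_floor]
      push_cast
      constructor <;> linarith
    · intro i hi j hj hij
      have h1 : (b : ℤ) ∣ a * ((i : ℤ) - j) := ⟨n i - n j, by simp only at hij; linarith⟩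
      have h2 : (b : ℤ) ∣ (i : ℤ) - j := hab.symm.dvd_of_dvd_mul_left h1
      have hi' := Finset.mem_range.mp (Finset.mem_filter.mp hi).1
      have hj' := Finset.mem_range.mp (Finset.mem_filter.mp hj).1
      have h3 := Int.eq_zero_of_abs_lt_dvd h2 (by rw [abs_lt]; omega)
      omega
  have hpos : (0 : ℝ) ≤ 2 * r * b + 1 := by positivity
  rw [Int.card_Icc] at hcard
  have h2 : ((⌊-(y * b) + r * b⌋ + 1 - ⌈-(y * b) - r * b⌉ : ℤ) : ℝ) ≤ 2 * r * b + 1 := by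
    push_cast
    have := Int.floor_le (-(y * b) + r * b)
    have := Int.le_ceil (-(y * b) - r * b)
    linarith
  calc (s.card : ℝ) ≤ ((⌊-(y * b) + r * b⌋ + 1 - ⌈-(y * b) - r * b⌉).toNat : ℝ) := by
        exact_mod_cast hcard
    _ = ((max (⌊-(y * b) + r * b⌋ + 1 - ⌈-(y * b) - r * b⌉) 0 : ℤ) : ℝ) := by
        rw [← Int.toNat_eq_max]; rfl
    _ ≤ _ := by
        rcases max_choice (⌊-(y * b) + r * b⌋ + 1 - ⌈-(y * b) - r * b⌉) 0 with h | h <;> rw [h]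
        · exact h2
        · simpa using hpos

theorem measurableSet_circle_inter (γ : UnitAddCircle) (a b : ℤ) (r r' : ℝ) :
    MeasurableSet {x : UnitAddCircle | ‖a • x - γ‖ ≤ r ∧ ‖b • x - γ‖ ≤ r'} := by
  have h : ∀ (n : ℤ) (t : ℝ), IsClosed {x : UnitAddCircle | ‖n • x - γ‖ ≤ t} := fun n t =>
    isClosed_le (by fun_prop) continuous_const
  exact ((h a r).inter (h b r')).measurableSet

/-- Overlap estimate on the circle for two coprime multipliers. -/
theorem measureReal_circle_inter_le (γ : UnitAddCircle) {a : ℤ} {b : ℕ} (hb : 0 < b)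
    (hab : IsCoprime a (b : ℤ)) {r r' : ℝ} (hr : 0 ≤ r) (hr' : 0 ≤ r') (hr1 : r' ≤ 1 / 2) :
    volume.real {x : UnitAddCircle | ‖a • x - γ‖ ≤ r ∧ ‖(b : ℤ) • x - γ‖ ≤ r'} ≤
      2 * r' * (2 * r + 1 / b) := by
  classical
  have hb' : (0 : ℝ) < b := by exact_mod_cast hb
  set E := {x : UnitAddCircle | ‖a • x - γ‖ ≤ r ∧ ‖(b : ℤ) • x - γ‖ ≤ r'} with hE
  set B := {x : UnitAddCircle | ‖(b : ℤ) • x - γ‖ ≤ r'} with hB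
  have hBm : MeasurableSet B := (isClosed_le (by fun_prop) continuous_const).measurableSet
  have hEm : MeasurableSet E :=
    measurableSet_circle_inter γ a b r r'
  have hBvol : volume.real B = 2 * r' := by
    have hmp := Measure.measurePreserving_zsmul (volume : Measure UnitAddCircle)
      (n := (b : ℤ)) (by omega)
    have e : B = (fun x : UnitAddCircle => (b : ℤ) • x) ⁻¹' Metric.closedBall γ r' := by
      ext x; simp [hB, dist_eq_norm]
    rw [e, Measure.real, hmp.measure_preimage Metric.isClosed_closedBall.measurableSet.nullMeasurableSet,
      ← Measure.real, measureReal_circle_closedBall _ hr' hr1]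
  have hint : Integrable (E.indicator (1 : UnitAddCircle → ℝ)) :=
    (integrable_const (1 : ℝ)).indicator hEm
  -- Average over the translations by `j / b`: they fix `b • x`, hence preserve `B`, while `a • x`
  -- runs through equally spaced points, of which at most `2rb + 1` lie within `r` of `γ`.
  have hbE : (b : ℝ) * volume.real E =
      ∫ x, ∑ j ∈ Finset.range b,
        E.indicator (1 : UnitAddCircle → ℝ) (x + (((j : ℝ) / b : ℝ) : UnitAddCircle)) := by
    rw [integral_finsetSum _ fun j _ => hint.comp_add_right _]
    simp only [integral_add_right_eq_self, integral_indicator_one hEm, Finset.sum_const,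
      Finset.card_range, nsmul_eq_mul]
  have hpt : ∀ x, ∑ j ∈ Finset.range b,
      E.indicator (1 : UnitAddCircle → ℝ) (x + (((j : ℝ) / b : ℝ) : UnitAddCircle)) ≤
        (2 * r * b + 1) * B.indicator (1 : UnitAddCircle → ℝ) x := by
    intro x
    have hbx : ∀ j : ℕ, (b : ℤ) • (x + (((j : ℝ) / b : ℝ) : UnitAddCircle)) = (b : ℤ) • x := by
      intro j
      rw [smul_add, ← AddCircle.coe_zsmul, zsmul_eq_mul]
      have : ((b : ℤ) : ℝ) * ((j : ℝ) / b) = ((j : ℤ) : ℝ) := by push_cast; field_simp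
      rw [this, UnitAddCircle.coe_intCast, add_zero]
    by_cases hx : x ∈ B
    · rw [Set.indicator_of_mem hx, Pi.one_apply, mul_one]
      refine le_trans (le_of_eq ?_) (card_filter_norm_add_le (a • x - γ) hb hab hr)
      rw [Finset.card_filter]
      push_cast
      refine Finset.sum_congr rfl fun j _ => ?_
      have hm : (x + (((j : ℝ) / b : ℝ) : UnitAddCircle)) ∈ E ↔
          ‖a • x - γ + a • (((j : ℝ) / b : ℝ) : UnitAddCircle)‖ ≤ r := by
        simp only [hE, Set.mem_ofPred_eq, hbx]
        rw [smul_add, add_sub_right_comm]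
        exact and_iff_left hx
      rw [Set.indicator_apply]
      simp only [hm, Pi.one_apply]
    · rw [Set.indicator_of_notMem hx, mul_zero]
      refine (Finset.sum_eq_zero fun j _ => Set.indicator_of_notMem (fun h => hx ?_) _).le
      have := h.2
      rwa [hbx] at this
  have hle : (b : ℝ) * volume.real E ≤ (2 * r * b + 1) * (2 * r') := by
    rw [hbE, ← hBvol, ← integral_indicator_one hBm, ← integral_const_mul]
    exact integral_mono (integrable_finsetSum _ fun j _ => hint.comp_add_right _)
      (((integrable_const (1 : ℝ)).indicator hBm).const_mul _) hpt
  rw [← mul_le_mul_iff_right₀ hb']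
  refine hle.trans (le_of_eq ?_)
  field_simp

/-- The character `α ↦ q · α` of the two-dimensional torus. -/
noncomputable def torusChar (q : ℤ × ℤ) : (Fin 2 → UnitAddCircle) →+ UnitAddCircle :=
  q.1 • Pi.evalAddMonoidHom _ 0 + q.2 • Pi.evalAddMonoidHom _ 1

theorem torusChar_apply (q : ℤ × ℤ) (α : Fin 2 → UnitAddCircle) :
    torusChar q α = q.1 • α 0 + q.2 • α 1 := rfl

theorem continuous_torusChar (q : ℤ × ℤ) : Continuous (torusChar q) := by
  have : (torusChar q : (Fin 2 → UnitAddCircle) → UnitAddCircle) =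
    fun α => q.1 • α 0 + q.2 • α 1 := rfl
  rw [this]
  fun_prop

theorem torusChar_smul (a : ℤ) (w : ℤ × ℤ) (α : Fin 2 → UnitAddCircle) :
    torusChar (a • w) α = a • torusChar w α := by
  simp only [torusChar_apply, Prod.smul_fst, Prod.smul_snd, smul_add, smul_eq_mul, mul_smul]

/-- A continuous surjective homomorphism of compact groups carries normalised Haar measure to
normalised Haar measure. Surjectivity is Cramer's rule, with division by the determinant possible
because the circle is divisible. -/
theorem measurePreserving_torusChar_prod {q q' : ℤ × ℤ} (h : q.1 * q'.2 - q.2 * q'.1 ≠ 0) :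
    MeasurePreserving (fun α => (torusChar q α, torusChar q' α)) volume
      ((volume : Measure UnitAddCircle).prod (volume : Measure UnitAddCircle)) := by
  have hs : Function.Surjective ((torusChar q).prod (torusChar q')) := by
    rintro ⟨y, y'⟩
    obtain ⟨z, hz⟩ := DivisibleBy.surjective_smul UnitAddCircle ℤ h y
    obtain ⟨z', hz'⟩ := DivisibleBy.surjective_smul UnitAddCircle ℤ h y'
    refine ⟨![q'.2 • z - q.2 • z', q.1 • z' - q'.1 • z], ?_⟩
    simp only at hz hz'
    rw [AddMonoidHom.prod_apply, torusChar_apply, torusChar_apply, ← hz, ← hz']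
    simp only [Matrix.cons_val_zero, Matrix.cons_val_one]
    ext <;> module
  exact ((torusChar q).prod (torusChar q')).measurePreserving
    ((continuous_torusChar q).prodMk (continuous_torusChar q')) hs
    (by rw [measure_univ, measure_univ])

theorem measurePreserving_torusChar {q : ℤ × ℤ} (h : q ≠ 0) :
    MeasurePreserving (torusChar q) := by
  have : ∃ q' : ℤ × ℤ, q.1 * q'.2 - q.2 * q'.1 ≠ 0 := by
    by_cases h1 : q.1 = 0
    · refine ⟨(1, 0), ?_⟩
      have : q.2 ≠ 0 := fun h2 => h (Prod.ext h1 h2)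
      simpa using this
    · exact ⟨(0, 1), by simpa using h1⟩
  obtain ⟨q', hq'⟩ := this
  exact measurePreserving_fst.comp (measurePreserving_torusChar_prod hq')

/-- The points `α` of the torus for which `q · α` is within `r` of `γ`. -/
def resonantSet (γ : UnitAddCircle) (r : ℝ) (q : ℤ × ℤ) : Set (Fin 2 → UnitAddCircle) :=
  {α | ‖torusChar q α - γ‖ ≤ r}

theorem resonantSet_eq (γ : UnitAddCircle) (r : ℝ) (q : ℤ × ℤ) :
    resonantSet γ r q = torusChar q ⁻¹' Metric.closedBall γ r := by
  ext x; simp [resonantSet, dist_eq_norm]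

theorem measurableSet_resonantSet (γ : UnitAddCircle) (r : ℝ) (q : ℤ × ℤ) :
    MeasurableSet (resonantSet γ r q) := by
  rw [resonantSet_eq]
  exact (Metric.isClosed_closedBall.preimage (continuous_torusChar q)).measurableSet

theorem measureReal_resonantSet (γ : UnitAddCircle) {r : ℝ} (h0 : 0 ≤ r) (h1 : r ≤ 1 / 2)
    {q : ℤ × ℤ} (hq : q ≠ 0) : volume.real (resonantSet γ r q) = 2 * r := by
  rw [resonantSet_eq, Measure.real, (measurePreserving_torusChar hq).measure_preimage
    Metric.isClosed_closedBall.measurableSet.nullMeasurableSet, ← Measure.real,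
    measureReal_circle_closedBall _ h0 h1]

/-- The two characters are independent uniform variables, so these pairs have zero covariance. -/
theorem measureReal_resonantSet_inter_of_det_ne_zero (γ : UnitAddCircle) {r r' : ℝ} (h0 : 0 ≤ r)
    (h1 : r ≤ 1 / 2) (h0' : 0 ≤ r') (h1' : r' ≤ 1 / 2) {q q' : ℤ × ℤ}
    (h : q.1 * q'.2 - q.2 * q'.1 ≠ 0) :
    volume.real (resonantSet γ r q ∩ resonantSet γ r' q') = 2 * r * (2 * r') := by
  have e : resonantSet γ r q ∩ resonantSet γ r' q' =
      (fun α => (torusChar q α, torusChar q' α)) ⁻¹'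
        (Metric.closedBall γ r ×ˢ Metric.closedBall γ r') := by
    rw [resonantSet_eq, resonantSet_eq]; rfl
  rw [e, Measure.real, (measurePreserving_torusChar_prod h).measure_preimage
    (Metric.isClosed_closedBall.measurableSet.prod
      Metric.isClosed_closedBall.measurableSet).nullMeasurableSet]
  rw [Measure.prod_prod, ENNReal.toReal_mul, ← Measure.real, ← Measure.real,
    measureReal_circle_closedBall _ h0 h1, measureReal_circle_closedBall _ h0' h1']

/-- Both sets depend only on the single character of `w`, which reduces the overlap to the circle.
-/
theorem measureReal_resonantSet_inter_le (γ : UnitAddCircle) {r r' : ℝ} (h0 : 0 ≤ r)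
    (h0' : 0 ≤ r') (h1' : r' ≤ 1 / 2) {w : ℤ × ℤ} (hw : w ≠ 0) {a : ℤ} {b : ℕ} (hb : 0 < b)
    (hab : IsCoprime a (b : ℤ)) :
    volume.real (resonantSet γ r (a • w) ∩ resonantSet γ r' ((b : ℤ) • w)) ≤
      2 * r' * (2 * r + 1 / b) := by
  have e : resonantSet γ r (a • w) ∩ resonantSet γ r' ((b : ℤ) • w) =
      torusChar w ⁻¹' {x : UnitAddCircle | ‖a • x - γ‖ ≤ r ∧ ‖(b : ℤ) • x - γ‖ ≤ r'} := by
    ext α; simp only [resonantSet, torusChar_smul]; rfl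
  have hm : MeasurableSet {x : UnitAddCircle | ‖a • x - γ‖ ≤ r ∧ ‖(b : ℤ) • x - γ‖ ≤ r'} :=
    measurableSet_circle_inter γ a b r r'
  rw [e, Measure.real, (measurePreserving_torusChar hw).measure_preimage hm.nullMeasurableSet,
    ← Measure.real]
  exact measureReal_circle_inter_le γ hb hab h0 h0' h1'

/-- Two resonant sets of parallel frequencies can only meet if a multiple of `γ` is small. -/
theorem norm_zsmul_le_of_mem_inter {γ : UnitAddCircle} {r r' : ℝ} {w : ℤ × ℤ} {a b : ℤ}
    {α : Fin 2 → UnitAddCircle}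
    (hα : α ∈ resonantSet γ r (a • w) ∩ resonantSet γ r' (b • w)) :
    ‖(a - b) • γ‖ ≤ |(b : ℝ)| * r + |(a : ℝ)| * r' := by
  obtain ⟨h1, h2⟩ := hα
  simp only [resonantSet, Set.mem_ofPred_eq, torusChar_smul] at h1 h2
  have hz : ∀ (n : ℤ) (x : UnitAddCircle), ‖n • x‖ ≤ |(n : ℝ)| * ‖x‖ := fun n x => by
    simpa [Int.norm_eq_abs] using norm_zsmul_le n x
  set x := torusChar w α
  -- Eliminating `x` between the two conditions leaves a multiple of `γ` alone.
  have e : (a - b) • γ = b • (a • x - γ) + (-a) • (b • x - γ) := by module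
  have h3 := hz b (a • x - γ)
  have h4 := hz (-a) (b • x - γ)
  push_cast at h4
  rw [abs_neg] at h4
  rw [e]
  refine (norm_add_le _ _).trans (add_le_add (h3.trans ?_) (h4.trans ?_)) <;> gcongr

theorem ae_torusChar_ne {q : ℤ × ℤ} (hq : q ≠ 0) (x : UnitAddCircle) :
    ∀ᵐ α : Fin 2 → UnitAddCircle, torusChar q α ≠ x := by
  have h : volume ({x} : Set UnitAddCircle) = 0 := by
    have := AddCircle.volume_closedBall (T := 1) (x := x) 0
    rwa [Metric.closedBall_zero, mul_zero, min_eq_right zero_le_one, ENNReal.ofReal_zero] at this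
  rw [ae_iff]
  simp only [ne_eq, not_not]
  exact ((measurePreserving_torusChar hq).measure_preimage
    (measurableSet_singleton x).nullMeasurableSet).trans h

end Torus

/-! ### Covariances of parallel frequencies and admissible denominators. -/

section Variance

/-- The maximum norm of a pair of integers. -/
def pairNorm (q : ℤ × ℤ) : ℕ := max q.1.natAbs q.2.natAbs

theorem pairNorm_pos {q : ℤ × ℤ} (hq : q ≠ 0) : 0 < pairNorm q := by
  by_contra h
  apply hq
  simp only [pairNorm] at h
  ext <;> simp <;> omega

theorem pairNorm_smul (a : ℤ) (w : ℤ × ℤ) : pairNorm (a • w) = a.natAbs * pairNorm w := by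
  simp only [pairNorm, Prod.smul_fst, Prod.smul_snd, smul_eq_mul, Int.natAbs_mul,
    Nat.mul_max_mul_left]

/-- Write the ratio of `q` to `q'` as a reduced fraction `a / b`, read off at a nonzero coordinate
of `q'`. Coprimality makes `b` divide both coordinates of `q'`, and the quotient is `w`. -/
theorem exists_coprime_smul_of_det_eq_zero {q q' : ℤ × ℤ} (hq' : q' ≠ 0)
    (hdet : q.1 * q'.2 - q.2 * q'.1 = 0) :
    ∃ (w : ℤ × ℤ) (a : ℤ) (b : ℕ), 0 < b ∧ IsCoprime a (b : ℤ) ∧ q = a • w ∧ q' = (b : ℤ) • w := by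
  obtain ⟨a, b, hb, hab, h1, h2⟩ : ∃ (a : ℤ) (b : ℕ), 0 < b ∧ IsCoprime a (b : ℤ) ∧
      (b : ℤ) * q.1 = a * q'.1 ∧ (b : ℤ) * q.2 = a * q'.2 := by
    have aux : ∀ x y : ℤ, y ≠ 0 → ∃ (a : ℤ) (b : ℕ), 0 < b ∧ IsCoprime a (b : ℤ) ∧
        (b : ℤ) * x = a * y := fun x y hy => by
      refine ⟨(x / y : ℚ).num, (x / y : ℚ).den, (x / y : ℚ).den_pos,
        Int.isCoprime_iff_nat_coprime.mpr (by simpa using (x / y : ℚ).reduced), ?_⟩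
      have h := Rat.num_div_den (x / y : ℚ)
      have hd : ((x / y : ℚ).den : ℚ) ≠ 0 := by exact_mod_cast (x / y : ℚ).den_ne_zero
      have hy' : (y : ℚ) ≠ 0 := by exact_mod_cast hy
      rw [div_eq_div_iff hd hy'] at h
      have : (((x / y : ℚ).den : ℤ) : ℚ) * x = (x / y : ℚ).num * y := by
        rw [h]; push_cast; ring
      exact_mod_cast this
    by_cases h0 : q'.1 = 0
    · have h0' : q'.2 ≠ 0 := fun h => hq' (Prod.ext h0 h)
      obtain ⟨a, b, hb, hab, h⟩ := aux q.2 q'.2 h0'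
      refine ⟨a, b, hb, hab, ?_, h⟩
      rw [h0, mul_zero, sub_zero] at hdet
      rw [(mul_eq_zero.mp hdet).resolve_right h0', h0, mul_zero, mul_zero]
    · obtain ⟨a, b, hb, hab, h⟩ := aux q.1 q'.1 h0
      refine ⟨a, b, hb, hab, h, mul_right_cancel₀ h0 ?_⟩
      linear_combination q'.2 * h - (b : ℤ) * hdet
  obtain ⟨w1, hw1⟩ : (b : ℤ) ∣ q'.1 := hab.symm.dvd_of_dvd_mul_left ⟨q.1, h1.symm⟩
  obtain ⟨w2, hw2⟩ : (b : ℤ) ∣ q'.2 := hab.symm.dvd_of_dvd_mul_left ⟨q.2, h2.symm⟩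
  have hb0 : (b : ℤ) ≠ 0 := by omega
  refine ⟨(w1, w2), a, b, hb, hab, ?_, Prod.ext hw1 hw2⟩
  ext
  · refine mul_left_cancel₀ hb0 ?_
    simp only [Prod.smul_mk, smul_eq_mul]
    rw [h1, hw1]; ring
  · refine mul_left_cancel₀ hb0 ?_
    simp only [Prod.smul_mk, smul_eq_mul]
    rw [h2, hw2]; ring

variable {ψ : ℕ → ℝ}

/-- The resonant set of the frequency `q` for the approximation function `ψ`. -/
def approxSet (ψ : ℕ → ℝ) (γ : ℝ) (q : ℤ × ℤ) : Set (Fin 2 → UnitAddCircle) :=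
  resonantSet γ (ψ (pairNorm q)) q

/-- The covariance of the resonant sets of two frequencies. -/
noncomputable def approxCov (ψ : ℕ → ℝ) (γ : ℝ) (q q' : ℤ × ℤ) : ℝ :=
  volume.real (approxSet ψ γ q ∩ approxSet ψ γ q') - 2 * ψ (pairNorm q) * (2 * ψ (pairNorm q'))

theorem approxCov_comm (ψ : ℕ → ℝ) (γ : ℝ) (q q' : ℤ × ℤ) :
    approxCov ψ γ q q' = approxCov ψ γ q' q := by
  simp only [approxCov, Set.inter_comm (approxSet ψ γ q)]
  ring

/-- The pairs of parallel frequencies with positive covariance have a large reduced denominator. -/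
theorem rpow_le_of_nonempty_inter {γ : ℝ} (hψ0 : ∀ q, 0 ≤ ψ q) {C₀ ε : ℝ} (hC₀ : 0 ≤ C₀)
    (hε : 0 < ε) (hdecay : ∀ q : ℕ, 0 < q → ψ q ≤ C₀ * (1 / (q : ℝ) ^ ε)) {n : ℕ}
    (hn : ∀ k : ℤ, k ≠ 0 → ∀ a : ℤ, 1 / (2 * |(k : ℝ)|) ^ n ≤ |(k : ℝ) * γ - a|)
    {w : ℤ × ℤ} (hw : w ≠ 0) {a : ℤ} {b : ℕ} (ha : a ≠ 0) (hab : a ≠ b) (hle : a.natAbs ≤ b)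
    (hne : (approxSet ψ γ (a • w) ∩ approxSet ψ γ ((b : ℤ) • w)).Nonempty) :
    (pairNorm ((b : ℤ) • w) : ℝ) ^ ε ≤ 4 ^ n * 2 * C₀ * (b : ℝ) ^ ((n : ℝ) + 1 + ε) := by
  obtain ⟨α, hα⟩ := hne
  have hb : 0 < b := by have := Int.natAbs_pos.mpr ha; omega
  have hbR : (0 : ℝ) < b := by exact_mod_cast hb
  have haR : |(a : ℝ)| ≤ b := by
    rw [← Int.cast_abs, Int.abs_eq_natAbs]; exact_mod_cast hle
  have hwpos := pairNorm_pos hw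
  have hwR : (0 : ℝ) < pairNorm w := by exact_mod_cast hwpos
  have h1 := norm_zsmul_le_of_mem_inter hα
  -- Here `2|a - b| ≤ 4b`, since `|a| ≤ b`.
  have hlow : 1 / (4 * (b : ℝ)) ^ n ≤ ‖(a - (b : ℤ)) • (γ : UnitAddCircle)‖ := by
    rw [← AddCircle.coe_zsmul, UnitAddCircle.norm_eq, zsmul_eq_mul]
    refine le_trans ?_ (hn _ (sub_ne_zero.mpr hab) _)
    have hpos : 0 < |((a - b : ℤ) : ℝ)| := abs_pos.mpr (by exact_mod_cast sub_ne_zero.mpr hab)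
    refine one_div_le_one_div_of_le (by positivity) ?_
    refine pow_le_pow_left₀ (by positivity) ?_ n
    have : |((a - b : ℤ) : ℝ)| ≤ |(a : ℝ)| + |(b : ℝ)| := by push_cast; exact abs_sub _ _
    rw [abs_of_pos hbR] at this
    linarith
  -- Both frequencies have norm at least that of `w`, so one decay bound serves for both.
  have hψw : ∀ m : ℕ, 0 < m → ψ (m * pairNorm w) ≤ C₀ * (1 / (pairNorm w : ℝ) ^ ε) := by
    intro m hm
    refine (hdecay _ (Nat.mul_pos hm hwpos)).trans ?_
    have hm1 : (1 : ℝ) ≤ m := by exact_mod_cast hm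
    push_cast
    gcongr
    nlinarith
  rw [pairNorm_smul, pairNorm_smul, Int.natAbs_natCast] at h1
  rw [Int.cast_natCast, abs_of_pos hbR] at h1
  have h2 := hψw _ (Int.natAbs_pos.mpr ha)
  have h3 := hψw b hb
  have h4 : 1 / (4 * (b : ℝ)) ^ n ≤ 2 * b * (C₀ * (1 / (pairNorm w : ℝ) ^ ε)) := by
    refine (hlow.trans h1).trans ?_
    have h5 : (b : ℝ) * ψ (a.natAbs * pairNorm w) ≤ b * (C₀ * (1 / (pairNorm w : ℝ) ^ ε)) := by
      gcongr
    have h6 : |(a : ℝ)| * ψ (b * pairNorm w) ≤ b * (C₀ * (1 / (pairNorm w : ℝ) ^ ε)) :=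
      mul_le_mul haR h3 (hψ0 _) hbR.le
    linarith
  rw [pairNorm_smul, Int.natAbs_natCast]
  push_cast
  rw [Real.mul_rpow hbR.le hwR.le, Real.rpow_add hbR, Real.rpow_add hbR, Real.rpow_natCast,
    Real.rpow_one]
  rw [div_le_iff₀ (by positivity), mul_pow] at h4
  have hwε : (0 : ℝ) < (pairNorm w : ℝ) ^ ε := by positivity
  have h7 : (pairNorm w : ℝ) ^ ε ≤ 2 * b * C₀ * (4 ^ n * (b : ℝ) ^ n) := by
    have := mul_le_mul_of_nonneg_right h4 hwε.le
    field_simp at this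
    linarith
  calc (b : ℝ) ^ ε * (pairNorm w : ℝ) ^ ε ≤ (b : ℝ) ^ ε * (2 * b * C₀ * (4 ^ n * (b : ℝ) ^ n)) := by
        gcongr
    _ = _ := by ring

open Classical in
/-- The admissible reduced denominators for the frequency `q`. -/
noncomputable def denomSet (C κ ε : ℝ) (q : ℤ × ℤ) : Finset ℕ :=
  (pairNorm q).divisors.filter fun b => ((b : ℤ) ∣ q.1 ∧ (b : ℤ) ∣ q.2) ∧
    (b = 1 ∨ (pairNorm q : ℝ) ^ ε ≤ C * (b : ℝ) ^ κ)

/-- A positive covariance requires `q = a w`, `q' = b w` and a nonempty intersection, which makes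
`b` admissible; the excess of the overlap over the product of the measures is then `2ψ(|q'|)/b`.
Writing this as a sum over all `a`, `b` of nonnegative terms allows the sum over `q` to be taken
first. -/
theorem max_approxCov_le {γ : ℝ} (hψ : ∀ q, ψ q ∈ Set.Icc (0 : ℝ) (1 / 2)) {C₀ ε : ℝ}
    (hC₀ : 0 ≤ C₀) (hε : 0 < ε) (hdecay : ∀ q : ℕ, 0 < q → ψ q ≤ C₀ * (1 / (q : ℝ) ^ ε)) {n : ℕ}
    (hn : ∀ k : ℤ, k ≠ 0 → ∀ a : ℤ, 1 / (2 * |(k : ℝ)|) ^ n ≤ |(k : ℝ) * γ - a|)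
    {q q' : ℤ × ℤ} (hq : q ≠ 0) (hq' : q' ≠ 0) (hle : pairNorm q ≤ pairNorm q') :
    max (approxCov ψ γ q q') 0 ≤ ∑ b ∈ denomSet (4 ^ n * 2 * C₀) (n + 1 + ε) ε q',
      ∑ a ∈ Finset.Icc (-(b : ℤ)) b,
        if (b : ℤ) • q = a • q' then 2 * ψ (pairNorm q') / b else 0 := by
  have hnn : ∀ (b : ℕ) (a : ℤ),
      0 ≤ if (b : ℤ) • q = a • q' then 2 * ψ (pairNorm q') / b else 0 := fun b a => by
    have := (hψ (pairNorm q')).1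
    split_ifs <;> positivity
  have hsum : 0 ≤ ∑ b ∈ denomSet (4 ^ n * 2 * C₀) (n + 1 + ε) ε q',
      ∑ a ∈ Finset.Icc (-(b : ℤ)) b,
        if (b : ℤ) • q = a • q' then 2 * ψ (pairNorm q') / b else 0 :=
    Finset.sum_nonneg fun b _ => Finset.sum_nonneg fun a _ => hnn b a
  refine max_le ?_ hsum
  by_cases hdet : q.1 * q'.2 - q.2 * q'.1 = 0
  swap
  · refine le_trans (le_of_eq ?_) hsum
    rw [approxCov, approxSet, approxSet, measureReal_resonantSet_inter_of_det_ne_zero _ (hψ _).1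
      (hψ _).2 (hψ _).1 (hψ _).2 hdet, sub_self]
  rcases le_or_gt (approxCov ψ γ q q') 0 with hc | hc
  · exact hc.trans hsum
  obtain ⟨w, a, b, hb, hab, rfl, rfl⟩ := exists_coprime_smul_of_det_eq_zero hq' hdet
  have hw : w ≠ 0 := by rintro rfl; simp at hq
  have ha : a ≠ 0 := by rintro rfl; simp at hq
  have hwpos := pairNorm_pos hw
  have hab' : a.natAbs ≤ b := by
    rw [pairNorm_smul, pairNorm_smul, Int.natAbs_natCast] at hle
    exact Nat.le_of_mul_le_mul_right hle hwpos
  have hmem : b ∈ denomSet (4 ^ n * 2 * C₀) (n + 1 + ε) ε ((b : ℤ) • w) := by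
    simp only [denomSet, Finset.mem_filter, Nat.mem_divisors]
    refine ⟨⟨⟨pairNorm w, by rw [pairNorm_smul, Int.natAbs_natCast]⟩, (pairNorm_pos hq').ne'⟩,
      ⟨⟨w.1, rfl⟩, ⟨w.2, rfl⟩⟩, ?_⟩
    by_cases hb1 : b = 1
    · exact Or.inl hb1
    refine Or.inr (rpow_le_of_nonempty_inter (fun q => (hψ q).1) hC₀ hε hdecay hn hw ha ?_ hab' ?_)
    -- If `a = b`, coprimality forces `b = 1`, which has been treated separately.
    · rintro rfl
      rw [isCoprime_self, Int.isUnit_iff] at hab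
      omega
    · by_contra hemp
      rw [Set.not_nonempty_iff_eq_empty] at hemp
      rw [approxCov, hemp, measureReal_empty] at hc
      nlinarith [(hψ (pairNorm (a • w))).1, (hψ (pairNorm ((b : ℤ) • w))).1]
  refine le_trans ?_ (Finset.single_le_sum (fun b _ => Finset.sum_nonneg fun a _ => hnn b a) hmem)
  refine le_trans ?_ (Finset.single_le_sum (fun a _ => hnn b a)
    (Finset.mem_Icc.mpr (by omega : -(b : ℤ) ≤ a ∧ a ≤ b)))
  rw [if_pos (smul_comm _ _ _)]
  have := measureReal_resonantSet_inter_le (γ : UnitAddCircle) (hψ (pairNorm (a • w))).1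
    (hψ (pairNorm ((b : ℤ) • w))).1 (hψ (pairNorm ((b : ℤ) • w))).2 hw hb hab
  rw [approxCov, approxSet, approxSet]
  refine (sub_le_sub_right this _).trans (le_of_eq ?_)
  ring

/-- Given `a` and `b`, at most one `q` satisfies `b q = a q'`. The `2b + 1` values of `a` therefore
cost at most `(2b + 1) · 2ψ/b ≤ 6ψ` for each admissible `b`. -/
theorem sum_max_approxCov_le {γ : ℝ} (hψ : ∀ q, ψ q ∈ Set.Icc (0 : ℝ) (1 / 2)) {C₀ ε : ℝ}
    (hC₀ : 0 ≤ C₀) (hε : 0 < ε) (hdecay : ∀ q : ℕ, 0 < q → ψ q ≤ C₀ * (1 / (q : ℝ) ^ ε)) {n : ℕ}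
    (hn : ∀ k : ℤ, k ≠ 0 → ∀ a : ℤ, 1 / (2 * |(k : ℝ)|) ^ n ≤ |(k : ℝ) * γ - a|)
    {q' : ℤ × ℤ} (hq' : q' ≠ 0) (I : Finset (ℤ × ℤ)) (hI : ∀ q ∈ I, q ≠ 0) :
    ∑ q ∈ I.filter fun q => pairNorm q ≤ pairNorm q', max (approxCov ψ γ q q') 0 ≤
      (denomSet (4 ^ n * 2 * C₀) (n + 1 + ε) ε q').card * (6 * ψ (pairNorm q')) := by
  refine (Finset.sum_le_sum fun q hq => max_approxCov_le hψ hC₀ hε hdecay hn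
    (hI q (Finset.mem_filter.mp hq).1) hq' (Finset.mem_filter.mp hq).2).trans ?_
  rw [Finset.sum_comm, ← nsmul_eq_mul]
  refine Finset.sum_le_card_nsmul _ _ _ fun b hb => ?_
  have hbpos : 0 < b := Nat.pos_of_mem_divisors (Finset.mem_filter.mp hb).1
  have hb1 : (1 : ℝ) ≤ b := by exact_mod_cast hbpos
  have hψ0 := (hψ (pairNorm q')).1
  rw [Finset.sum_comm]
  have hinner : ∀ a ∈ Finset.Icc (-(b : ℤ)) b,
      (∑ q ∈ I.filter fun q => pairNorm q ≤ pairNorm q',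
        if (b : ℤ) • q = a • q' then 2 * ψ (pairNorm q') / b else 0) ≤
        2 * ψ (pairNorm q') / b := by
    intro a _
    rw [← Finset.sum_filter, Finset.sum_const, nsmul_eq_mul]
    refine mul_le_of_le_one_left (by positivity) ?_
    have : (Finset.filter (fun q => (b : ℤ) • q = a • q')
        (I.filter fun q => pairNorm q ≤ pairNorm q')).card ≤ 1 := by
      refine Finset.card_le_one.mpr fun x hx y hy => ?_
      have h := (Finset.mem_filter.mp hx).2.trans (Finset.mem_filter.mp hy).2.symm
      exact smul_right_injective _ (by omega : (b : ℤ) ≠ 0) h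
    exact_mod_cast this
  refine (Finset.sum_le_card_nsmul _ _ _ hinner).trans ?_
  rw [Int.card_Icc, nsmul_eq_mul, show ((b : ℤ) + 1 - -(b : ℤ)).toNat = 2 * b + 1 by omega]
  push_cast
  rw [mul_div_assoc', div_le_iff₀ (by linarith)]
  nlinarith

/-- Dividing by `b` sends these vectors into the box of radius `h / b`. -/
theorem card_filter_box_dvd_le {h b : ℕ} (hh : h ≠ 0) (hb : b ∣ h) :
    (((Finset.box h : Finset (ℤ × ℤ)).filter fun q => (b : ℤ) ∣ q.1 ∧ (b : ℤ) ∣ q.2).card : ℝ) ≤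
      8 * h / b := by
  obtain ⟨k, rfl⟩ := hb
  have hb0 : b ≠ 0 := by rintro rfl; simp at hh
  have hk0 : k ≠ 0 := by rintro rfl; simp at hh
  have hsub : ((Finset.box (b * k) : Finset (ℤ × ℤ)).filter
      fun q => (b : ℤ) ∣ q.1 ∧ (b : ℤ) ∣ q.2) ⊆
        (Finset.box k : Finset (ℤ × ℤ)).image fun w => (b : ℤ) • w := by
    rintro ⟨x, y⟩ hq
    obtain ⟨hbox, ⟨u, rfl⟩, ⟨v, rfl⟩⟩ := Finset.mem_filter.mp hq
    refine Finset.mem_image.mpr ⟨(u, v), ?_, rfl⟩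
    rw [Int.mem_box] at hbox ⊢
    simp only [Int.natAbs_mul, Int.natAbs_natCast, Nat.mul_max_mul_left] at hbox
    exact Nat.eq_of_mul_eq_mul_left (Nat.pos_of_ne_zero hb0) hbox
  have hc := (Finset.card_le_card hsub).trans Finset.card_image_le
  rw [Int.card_box hk0] at hc
  have : (b : ℝ) ≠ 0 := by exact_mod_cast hb0
  calc _ ≤ ((8 * k : ℕ) : ℝ) := by exact_mod_cast hc
    _ = _ := by push_cast; field_simp

/-- The total number of admissible denominators over a box is of the order of the box. -/
theorem exists_sum_card_denomSet_le {C κ ε : ℝ} (hC : 0 ≤ C) (hκ : 0 < κ) (hε : 0 < ε) :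
    ∃ K : ℝ, 0 ≤ K ∧ ∀ h : ℕ, h ≠ 0 →
      ∑ q ∈ (Finset.box h : Finset (ℤ × ℤ)), ((denomSet C κ ε q).card : ℝ) ≤ K * h := by
  classical
  -- The exponent `ε / κ` is matched to the size of the admissible denominators: `b ≠ 1` gives `1 /
  -- b ≪ h ^ (-ε / κ)`, which cancels the number of divisors exactly.
  obtain ⟨T, hT, hdiv⟩ := card_divisors_le_rpow (s := ε / κ) (by positivity)
  refine ⟨8 * (1 + T * C ^ (1 / κ)), by positivity, fun h hh => ?_⟩
  have hhR : (0 : ℝ) < h := by exact_mod_cast Nat.pos_of_ne_zero hh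
  set good : Finset ℕ := h.divisors.filter fun b => b = 1 ∨ (h : ℝ) ^ ε ≤ C * (b : ℝ) ^ κ with hgood
  have e1 : ∀ q ∈ (Finset.box h : Finset (ℤ × ℤ)), ((denomSet C κ ε q).card : ℝ) =
      ∑ b ∈ good, if ((b : ℤ) ∣ q.1 ∧ (b : ℤ) ∣ q.2) then 1 else 0 := by
    intro q hq
    have hqn : pairNorm q = h := Int.mem_box.mp hq
    rw [denomSet, hqn, ← Finset.filter_filter, Finset.filter_comm, ← hgood, Finset.card_filter]
    push_cast
    rfl
  rw [Finset.sum_congr rfl e1, Finset.sum_comm]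
  have e2 : ∀ b ∈ good, (∑ q ∈ (Finset.box h : Finset (ℤ × ℤ)),
      if ((b : ℤ) ∣ q.1 ∧ (b : ℤ) ∣ q.2) then (1 : ℝ) else 0) ≤
      8 * h * ((if b = 1 then 1 else 0) + C ^ (1 / κ) * (1 / (h : ℝ) ^ (ε / κ))) := by
    intro b hb
    obtain ⟨hbd, hbg⟩ := Finset.mem_filter.mp hb
    have hbpos : (0 : ℝ) < b := by exact_mod_cast Nat.pos_of_mem_divisors hbd
    have h1 := card_filter_box_dvd_le hh (Nat.dvd_of_mem_divisors hbd)
    rw [Finset.card_filter] at h1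
    push_cast at h1
    refine h1.trans ?_
    rw [mul_div_assoc]
    have h2 : 1 / (b : ℝ) ≤ (if b = 1 then 1 else 0) + C ^ (1 / κ) * (1 / (h : ℝ) ^ (ε / κ)) := by
      rcases hbg with rfl | hbg
      · have : 0 ≤ C ^ (1 / κ) * (1 / (h : ℝ) ^ (ε / κ)) := by positivity
        simp only [Nat.cast_one, div_one, if_true]
        linarith
      · have h3 : (h : ℝ) ^ (ε / κ) ≤ C ^ (1 / κ) * b := by
          have h4 := Real.rpow_le_rpow (by positivity) hbg (by positivity : 0 ≤ 1 / κ)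
          rwa [← Real.rpow_mul hhR.le, Real.mul_rpow hC (by positivity), ← Real.rpow_mul hbpos.le,
            mul_one_div_cancel hκ.ne', Real.rpow_one, mul_one_div] at h4
        have h5 : 1 / (b : ℝ) ≤ C ^ (1 / κ) * (1 / (h : ℝ) ^ (ε / κ)) := by
          rw [mul_one_div, div_le_div_iff₀ hbpos (by positivity)]
          linarith
        have h6 : (0 : ℝ) ≤ if b = 1 then 1 else 0 := by split_ifs <;> norm_num
        linarith
    calc 8 * ((h : ℝ) / b) = 8 * h * (1 / b) := by ring
      _ ≤ _ := by gcongr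
  refine (Finset.sum_le_sum e2).trans ?_
  rw [← Finset.mul_sum, Finset.sum_add_distrib, Finset.sum_const, nsmul_eq_mul]
  have e3 : (∑ b ∈ good, if b = 1 then (1 : ℝ) else 0) ≤ 1 := by
    rw [Finset.sum_ite_eq']
    split_ifs <;> norm_num
  have e4 : (good.card : ℝ) * (C ^ (1 / κ) * (1 / (h : ℝ) ^ (ε / κ))) ≤ T * C ^ (1 / κ) := by
    have h1 : (good.card : ℝ) ≤ T * (h : ℝ) ^ (ε / κ) :=
      le_trans (by exact_mod_cast Finset.card_filter_le _ _) (hdiv h hh)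
    calc _ ≤ (T * (h : ℝ) ^ (ε / κ)) * (C ^ (1 / κ) * (1 / (h : ℝ) ^ (ε / κ))) := by gcongr
      _ = _ := by field_simp
  calc _ ≤ 8 * (h : ℝ) * (1 + T * C ^ (1 / κ)) := by gcongr
    _ = _ := by ring

end Variance

/-! ### From the variance bound to the counting function. -/

section Counting

variable {ψ : ℕ → ℝ}

/-- The frequencies `q` with `m < |q| ≤ n`. -/
noncomputable def shell (m n : ℕ) : Finset (ℤ × ℤ) := (Finset.Ioc m n).biUnion Finset.box

theorem mem_shell {m n : ℕ} {q : ℤ × ℤ} : q ∈ shell m n ↔ m < pairNorm q ∧ pairNorm q ≤ n := by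
  simp only [shell, Finset.mem_biUnion, Finset.mem_Ioc, Int.mem_box, pairNorm]
  constructor
  · rintro ⟨h, hh, rfl⟩; exact hh
  · intro h; exact ⟨_, h, rfl⟩

theorem ne_zero_of_mem_shell {m n : ℕ} {q : ℤ × ℤ} (hq : q ∈ shell m n) : q ≠ 0 := by
  rintro rfl
  have := (mem_shell.mp hq).1
  simp [pairNorm] at this

theorem sum_shell (m n : ℕ) (f : ℤ × ℤ → ℝ) :
    ∑ q ∈ shell m n, f q = ∑ h ∈ Finset.Ioc m n, ∑ q ∈ Finset.box h, f q := by
  refine Finset.sum_biUnion fun x _ y _ hxy => Finset.disjoint_left.mpr fun q hx hy => hxy ?_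
  rw [Int.mem_box] at hx hy
  exact hx.symm.trans hy

theorem sum_shell_add {m n : ℕ} (h : m ≤ n) (f : ℤ × ℤ → ℝ) :
    ∑ q ∈ shell 0 m, f q + ∑ q ∈ shell m n, f q = ∑ q ∈ shell 0 n, f q := by
  rw [sum_shell, sum_shell, sum_shell, Finset.sum_Ioc_consecutive _ (Nat.zero_le m) h]

theorem sum_box_const {h : ℕ} (hh : h ≠ 0) (f : ℕ → ℝ) :
    ∑ q ∈ (Finset.box h : Finset (ℤ × ℤ)), f (pairNorm q) = 8 * h * f h := by
  have e : ∀ q ∈ (Finset.box h : Finset (ℤ × ℤ)), f (pairNorm q) = f h := fun q hq =>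
    congrArg f (Int.mem_box.mp hq)
  rw [Finset.sum_congr rfl e, Finset.sum_const, Int.card_box hh, nsmul_eq_mul]
  push_cast
  ring

/-- The number of frequencies `0 < |q| ≤ n` whose resonant set contains `α`. -/
noncomputable def resonanceCount (ψ : ℕ → ℝ) (γ : ℝ) (n : ℕ) (α : Fin 2 → UnitAddCircle) : ℝ :=
  ∑ q ∈ shell 0 n, (approxSet ψ γ q).indicator 1 α

theorem measurableSet_approxSet (γ : ℝ) (q : ℤ × ℤ) : MeasurableSet (approxSet ψ γ q) :=
  measurableSet_resonantSet _ _ _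

theorem memLp_resonanceCount (γ : ℝ) (n : ℕ) : MemLp (resonanceCount ψ γ n) 2 := by
  have : resonanceCount ψ γ n = fun α => ∑ q ∈ shell 0 n, (approxSet ψ γ q).indicator 1 α := rfl
  rw [this]
  exact memLp_finsetSum _ fun q _ =>
    memLp_indicator_const 2 (measurableSet_approxSet γ q) (1 : ℝ) (Or.inr (measure_ne_top _ _))

theorem resonanceCount_mono (γ : ℝ) (α : Fin 2 → UnitAddCircle) :
    Monotone fun n => resonanceCount ψ γ n α := by
  intro m n h
  simp only [resonanceCount]
  rw [← sum_shell_add h]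
  exact le_add_of_nonneg_right (Finset.sum_nonneg fun q _ =>
    Set.indicator_nonneg (fun _ _ => zero_le_one) _)

theorem integral_indicator_sub_mul {γ : ℝ} (hψ : ∀ q, ψ q ∈ Set.Icc (0 : ℝ) (1 / 2))
    {q q' : ℤ × ℤ} (hq : q ≠ 0) (hq' : q' ≠ 0) :
    ∫ α, ((approxSet ψ γ q).indicator (1 : (Fin 2 → UnitAddCircle) → ℝ) α - 2 * ψ (pairNorm q)) *
      ((approxSet ψ γ q').indicator (1 : (Fin 2 → UnitAddCircle) → ℝ) α - 2 * ψ (pairNorm q')) =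
        approxCov ψ γ q q' := by
  have hm := measurableSet_approxSet (ψ := ψ) γ q
  have hm' := measurableSet_approxSet (ψ := ψ) γ q'
  have hi : ∀ {s : Set (Fin 2 → UnitAddCircle)}, MeasurableSet s →
      Integrable (s.indicator (1 : (Fin 2 → UnitAddCircle) → ℝ)) := fun hs => (integrable_const (1 : ℝ)).indicator hs
  have v := measureReal_resonantSet (γ : UnitAddCircle) (hψ (pairNorm q)).1 (hψ (pairNorm q)).2 hq
  have v' := measureReal_resonantSet (γ : UnitAddCircle) (hψ (pairNorm q')).1
    (hψ (pairNorm q')).2 hq'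
  rw [← approxSet] at v v'
  have e : ∀ α, ((approxSet ψ γ q).indicator (1 : (Fin 2 → UnitAddCircle) → ℝ) α - 2 * ψ (pairNorm q)) *
      ((approxSet ψ γ q').indicator (1 : (Fin 2 → UnitAddCircle) → ℝ) α - 2 * ψ (pairNorm q')) =
      (approxSet ψ γ q ∩ approxSet ψ γ q').indicator (1 : (Fin 2 → UnitAddCircle) → ℝ) α
        - 2 * ψ (pairNorm q') * (approxSet ψ γ q).indicator (1 : (Fin 2 → UnitAddCircle) → ℝ) α
        - 2 * ψ (pairNorm q) * (approxSet ψ γ q').indicator (1 : (Fin 2 → UnitAddCircle) → ℝ) α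
        + 2 * ψ (pairNorm q) * (2 * ψ (pairNorm q')) := by
    intro α
    rw [Set.inter_indicator_one, Pi.mul_apply]
    ring
  simp_rw [e]
  have i1 : ∀ c : ℝ, Integrable fun α => c * (approxSet ψ γ q).indicator
      (1 : (Fin 2 → UnitAddCircle) → ℝ) α := fun c => (hi hm).const_mul c
  have i2 : ∀ c : ℝ, Integrable fun α => c * (approxSet ψ γ q').indicator
      (1 : (Fin 2 → UnitAddCircle) → ℝ) α := fun c => (hi hm').const_mul c
  have i3 : ∀ c : ℝ, Integrable fun α => (approxSet ψ γ q ∩ approxSet ψ γ q').indicator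
      (1 : (Fin 2 → UnitAddCircle) → ℝ) α - c * (approxSet ψ γ q).indicator
      (1 : (Fin 2 → UnitAddCircle) → ℝ) α := fun c => (hi (hm.inter hm')).sub (i1 c)
  have i4 : ∀ c d : ℝ, Integrable fun α => (approxSet ψ γ q ∩ approxSet ψ γ q').indicator
      (1 : (Fin 2 → UnitAddCircle) → ℝ) α - c * (approxSet ψ γ q).indicator
      (1 : (Fin 2 → UnitAddCircle) → ℝ) α - d * (approxSet ψ γ q').indicator
      (1 : (Fin 2 → UnitAddCircle) → ℝ) α := fun c d => (i3 c).sub (i2 d)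
  rw [integral_add (i4 _ _) (integrable_const _), integral_sub (i3 _) (i2 _),
    integral_sub (hi (hm.inter hm')) (i1 _), integral_const_mul, integral_const_mul,
    integral_indicator_one (hm.inter hm'), integral_indicator_one hm, integral_indicator_one hm',
    integral_const, v, v', probReal_univ, one_smul, approxCov]
  ring

/-- The variance of the number of resonances in a shell. -/
theorem exists_variance_shell_le {γ : ℝ} (hγ : Irrational γ) (hL : ¬ Liouville γ)
    (hψ : ∀ q, ψ q ∈ Set.Icc (0 : ℝ) (1 / 2)) {C₀ ε : ℝ} (hC₀ : 0 ≤ C₀) (hε : 0 < ε)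
    (hdecay : ∀ q : ℕ, 0 < q → ψ q ≤ C₀ * (1 / (q : ℝ) ^ ε)) :
    ∃ K : ℝ, 0 ≤ K ∧ ∀ m n : ℕ,
      ∫ α, (∑ q ∈ shell m n,
        ((approxSet ψ γ q).indicator (1 : (Fin 2 → UnitAddCircle) → ℝ) α - 2 * ψ (pairNorm q))) ^ 2 ≤
          K * ∑ h ∈ Finset.Ioc m n, (h : ℝ) * ψ h := by
  classical
  obtain ⟨N, hN⟩ := exists_le_abs_mul_sub_of_not_liouville hγ hL
  obtain ⟨K, hK, hcard⟩ := exists_sum_card_denomSet_le (C := 4 ^ N * 2 * C₀) (κ := N + 1 + ε)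
    (ε := ε) (by positivity) (by positivity) hε
  refine ⟨12 * K, by positivity, fun m n => ?_⟩
  set I := shell m n with hI
  have hI0 : ∀ q ∈ I, q ≠ 0 := fun q hq => ne_zero_of_mem_shell hq
  have hmem : ∀ q : ℤ × ℤ, MemLp (fun α => (approxSet ψ γ q).indicator (1 : (Fin 2 → UnitAddCircle) → ℝ) α
      - 2 * ψ (pairNorm q)) 2 := fun q =>
    (memLp_indicator_const 2 (measurableSet_approxSet γ q) (1 : ℝ)
      (Or.inr (measure_ne_top _ _))).sub (memLp_const _)
  have hint : ∀ q q' : ℤ × ℤ, Integrable fun α =>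
      ((approxSet ψ γ q).indicator (1 : (Fin 2 → UnitAddCircle) → ℝ) α - 2 * ψ (pairNorm q)) *
      ((approxSet ψ γ q').indicator (1 : (Fin 2 → UnitAddCircle) → ℝ) α - 2 * ψ (pairNorm q')) := fun q q' =>
    (hmem q).integrable_mul (hmem q')
  have hexp : ∫ α, (∑ q ∈ I,
      ((approxSet ψ γ q).indicator (1 : (Fin 2 → UnitAddCircle) → ℝ) α - 2 * ψ (pairNorm q))) ^ 2 =
      ∑ q ∈ I, ∑ q' ∈ I, approxCov ψ γ q q' := by
    simp_rw [sq, Finset.sum_mul_sum]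
    rw [integral_finsetSum _ fun q _ => integrable_finsetSum _ fun q' _ => hint q q']
    refine Finset.sum_congr rfl fun q hq => ?_
    rw [integral_finsetSum _ fun q' _ => hint q q']
    exact Finset.sum_congr rfl fun q' hq' =>
      integral_indicator_sub_mul hψ (hI0 q hq) (hI0 q' hq')
  -- Ordering each pair by norm puts the reduced denominator on the longer vector; negative
  -- covariances are discarded.
  set A : ℤ × ℤ → ℤ × ℤ → ℝ := fun q q' =>
    if pairNorm q ≤ pairNorm q' then max (approxCov ψ γ q q') 0 else 0 with hA
  have hA0 : ∀ q q', 0 ≤ A q q' := fun q q' => by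
    simp only [hA]; split_ifs <;> simp
  have hcov : ∀ q q', approxCov ψ γ q q' ≤ A q q' + A q' q := by
    intro q q'
    rcases le_total (pairNorm q) (pairNorm q') with h | h
    · have : approxCov ψ γ q q' ≤ A q q' := by
        simp only [hA, if_pos h]; exact le_max_left _ _
      linarith [hA0 q' q]
    · have : approxCov ψ γ q q' ≤ A q' q := by
        simp only [hA, if_pos h]; rw [approxCov_comm]; exact le_max_left _ _
      linarith [hA0 q q']
  have hsumA : ∑ q' ∈ I, ∑ q ∈ I, A q q' ≤ 6 * K * ∑ h ∈ Finset.Ioc m n, (h : ℝ) * ψ h := by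
    calc ∑ q' ∈ I, ∑ q ∈ I, A q q'
        ≤ ∑ q' ∈ I, ((denomSet (4 ^ N * 2 * C₀) (N + 1 + ε) ε q').card : ℝ) *
            (6 * ψ (pairNorm q')) := by
          refine Finset.sum_le_sum fun q' hq' => ?_
          simp only [hA]
          rw [← Finset.sum_filter]
          exact sum_max_approxCov_le hψ hC₀ hε hdecay hN (hI0 q' hq') I hI0
      _ = ∑ h ∈ Finset.Ioc m n, (∑ q ∈ Finset.box h,
            ((denomSet (4 ^ N * 2 * C₀) (N + 1 + ε) ε q).card : ℝ)) * (6 * ψ h) := by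
          rw [hI, sum_shell]
          refine Finset.sum_congr rfl fun h _ => ?_
          rw [Finset.sum_mul]
          refine Finset.sum_congr rfl fun q hq => ?_
          rw [show pairNorm q = h from Int.mem_box.mp hq]
      _ ≤ ∑ h ∈ Finset.Ioc m n, (K * h) * (6 * ψ h) := by
          refine Finset.sum_le_sum fun h hh => ?_
          have h0 : h ≠ 0 := by have := (Finset.mem_Ioc.mp hh).1; omega
          exact mul_le_mul_of_nonneg_right (hcard h h0) (by linarith [(hψ h).1])
      _ = _ := by
          rw [Finset.mul_sum]
          exact Finset.sum_congr rfl fun h _ => by ring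
  rw [hexp]
  calc ∑ q ∈ I, ∑ q' ∈ I, approxCov ψ γ q q' ≤ ∑ q ∈ I, ∑ q' ∈ I, (A q q' + A q' q) :=
        Finset.sum_le_sum fun q _ => Finset.sum_le_sum fun q' _ => hcov q q'
    _ = ∑ q' ∈ I, ∑ q ∈ I, A q q' + ∑ q' ∈ I, ∑ q ∈ I, A q q' := by
        simp_rw [Finset.sum_add_distrib]
        congr 1
        exact Finset.sum_comm
    _ ≤ _ := by linarith

theorem sum_shell_two_mul (m n : ℕ) :
    ∑ q ∈ shell m n, 2 * ψ (pairNorm q) = 16 * ∑ h ∈ Finset.Ioc m n, (h : ℝ) * ψ h := by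
  rw [sum_shell, Finset.mul_sum]
  refine Finset.sum_congr rfl fun h hh => ?_
  have h0 : h ≠ 0 := by have := (Finset.mem_Ioc.mp hh).1; omega
  rw [sum_box_const h0 fun h => 2 * ψ h]
  ring

/-- Since `ψ ≤ 1/2`, adding `ψ(n + 1)` to a partial sum of size at most `n/2` raises the square by
at most `(n + 1) ψ(n + 1)`. This makes `8 ∑ ψ` an error term. -/
theorem sq_sum_le_sum_mul (hψ : ∀ q, ψ q ∈ Set.Icc (0 : ℝ) (1 / 2)) (n : ℕ) :
    (∑ q ∈ Finset.Icc 1 n, ψ q) ^ 2 ≤ ∑ q ∈ Finset.Icc 1 n, (q : ℝ) * ψ q := by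
  induction n with
  | zero => simp
  | succ n ih =>
    rw [Finset.sum_Icc_succ_top (by omega), Finset.sum_Icc_succ_top (by omega)]
    have h1 : ∑ q ∈ Finset.Icc 1 n, ψ q ≤ n * (1 / 2) := by
      have := Finset.sum_le_card_nsmul (Finset.Icc 1 n) ψ (1 / 2) fun q _ => (hψ q).2
      simpa [nsmul_eq_mul] using this
    have h2 := hψ (n + 1)
    push_cast
    nlinarith [h2.1, h2.2, mul_le_mul_of_nonneg_left h1 h2.1, mul_le_mul_of_nonneg_left h2.2 h2.1]

/-- The pair of coordinates of an integer vector. -/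
def toPair (q : Fin 2 → ℤ) : ℤ × ℤ := (q 0, q 1)

theorem toPair_injective : Function.Injective toPair := by
  intro q q' h
  simp only [toPair, Prod.mk.injEq] at h
  ext i
  fin_cases i
  exacts [h.1, h.2]

theorem mem_approxSet_iff {γ : ℝ} {a : Fin 2 → ℝ} {α : Fin 2 → UnitAddCircle}
    (ha : ∀ i, (a i : UnitAddCircle) = α i) (q : ℤ × ℤ) :
    α ∈ approxSet ψ γ q ↔
      ∃ p : ℤ, |(q.1 : ℝ) * a 0 + (q.2 : ℝ) * a 1 - p - γ| ≤ ψ (pairNorm q) := by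
  have : torusChar q α - (γ : UnitAddCircle) =
      (((q.1 : ℝ) * a 0 + (q.2 : ℝ) * a 1 - γ : ℝ) : UnitAddCircle) := by
    rw [torusChar_apply, ← ha, ← ha, AddCircle.coe_sub, AddCircle.coe_add, ← zsmul_eq_mul,
      ← zsmul_eq_mul, AddCircle.coe_zsmul, AddCircle.coe_zsmul]
  change ‖torusChar q α - (γ : UnitAddCircle)‖ ≤ _ ↔ _
  rw [this, UnitAddCircle.norm_coe_le_iff]
  simp only [sub_right_comm]

/-- Away from a null set the counting function is the number of resonances, up to the
contribution of the frequency zero. -/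
theorem countN_eq {γ : ℝ} (hψ : ∀ q, ψ q ∈ Set.Icc (0 : ℝ) (1 / 2)) {a : Fin 2 → ℝ}
    {α : Fin 2 → UnitAddCircle} (ha : ∀ i, (a i : UnitAddCircle) = α i)
    (hα : ∀ q : ℤ × ℤ, q ≠ 0 → torusChar q α ≠ ((γ + 1 / 2 : ℝ) : UnitAddCircle)) (Q : ℕ) :
    (countN ψ γ a Q : ℝ) = countN ψ γ a 0 + resonanceCount ψ γ Q α := by
  classical
  have hfin := goodApprox_finite ψ γ a Q
  have hsplit : goodApprox ψ γ a Q =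
      goodApprox ψ γ a 0 ∪ {x ∈ goodApprox ψ γ a Q | 0 < supNorm x.2} := by
    ext x
    simp only [goodApprox, Set.mem_union, Set.mem_ofPred_eq]
    constructor
    · rintro ⟨h1, h2⟩
      rcases Nat.eq_zero_or_pos (supNorm x.2) with h | h
      · exact Or.inl ⟨h.le, h2⟩
      · exact Or.inr ⟨⟨h1, h2⟩, h⟩
    · rintro (⟨h1, h2⟩ | ⟨h, -⟩)
      · exact ⟨h1.trans (Nat.zero_le _), h2⟩
      · exact h
  have hdisj : Disjoint (goodApprox ψ γ a 0) {x ∈ goodApprox ψ γ a Q | 0 < supNorm x.2} := by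
    rw [Set.disjoint_left]
    rintro x ⟨h1, -⟩ ⟨-, h2⟩
    omega
  have hcount : {x ∈ goodApprox ψ γ a Q | 0 < supNorm x.2}.ncard =
      ((shell 0 Q).filter fun q => α ∈ approxSet ψ γ q).card := by
    rw [← Set.ncard_coe_finset]
    refine Set.ncard_congr (fun x _ => toPair x.2) ?_ ?_ ?_
    · rintro ⟨p, q⟩ ⟨⟨h1, h2⟩, h3⟩
      rw [Finset.mem_coe, Finset.mem_filter, mem_shell, mem_approxSet_iff ha]
      exact ⟨⟨h3, h1⟩, p, h2⟩
    · rintro ⟨p, q⟩ ⟨p', q'⟩ ⟨⟨-, h2⟩, h3⟩ ⟨⟨-, h2'⟩, -⟩ hqq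
      obtain rfl : q = q' := toPair_injective hqq
      simp only [Prod.mk.injEq, and_true]
      by_contra hne
      simp only at h2 h2' h3
      have hq0 : toPair q ≠ 0 := by
        intro h
        have : supNorm q = pairNorm (toPair q) := rfl
        rw [this, h] at h3
        simp [pairNorm] at h3
      have hhalf := (hψ (supNorm q)).2
      rw [abs_le] at h2 h2'
      -- Two integers for one `q` lie within `2ψ ≤ 1` of each other, so they are consecutive with `ψ
      -- = 1/2`, and `q · a` is `γ + 1/2` modulo 1, which is excluded.
      have key : ∀ t t' : ℤ, t < t' →
          (q 0 : ℝ) * a 0 + (q 1 : ℝ) * a 1 - t - γ ≤ ψ (supNorm q) →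
          -ψ (supNorm q) ≤ (q 0 : ℝ) * a 0 + (q 1 : ℝ) * a 1 - t' - γ → False := by
        intro t t' htt u1 u2
        have h5 : (t : ℝ) + 1 ≤ t' := by exact_mod_cast htt
        have h6 : (q 0 : ℝ) * a 0 + (q 1 : ℝ) * a 1 = (t : ℤ) + (γ + 1 / 2) := by linarith
        refine hα (toPair q) hq0 ?_
        rw [torusChar_apply, ← ha, ← ha, ← AddCircle.coe_zsmul, ← AddCircle.coe_zsmul,
          ← AddCircle.coe_add, zsmul_eq_mul, zsmul_eq_mul]
        change (((q 0 : ℝ) * a 0 + (q 1 : ℝ) * a 1 : ℝ) : UnitAddCircle) = _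
        rw [h6, AddCircle.coe_add, UnitAddCircle.coe_intCast, zero_add]
      rcases lt_or_gt_of_ne hne with h | h
      · exact key p p' h h2.2 h2'.1
      · exact key p' p h h2'.2 h2.1
    · rintro q hq
      rw [Finset.mem_coe, Finset.mem_filter, mem_shell, mem_approxSet_iff ha] at hq
      obtain ⟨⟨h1, h2⟩, p, hp⟩ := hq
      exact ⟨(p, ![q.1, q.2]), ⟨⟨h2, hp⟩, h1⟩, rfl⟩
  have hres : resonanceCount ψ γ Q α =
      ((shell 0 Q).filter fun q => α ∈ approxSet ψ γ q).card := by
    rw [Finset.card_filter, resonanceCount]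
    push_cast
    exact Finset.sum_congr rfl fun q _ => by rw [Set.indicator_apply]; rfl
  have hcard : countN ψ γ a Q =
      countN ψ γ a 0 + {x ∈ goodApprox ψ γ a Q | 0 < supNorm x.2}.ncard := by
    rw [countN, countN, ← Set.ncard_union_eq hdisj (goodApprox_finite ψ γ a 0)
      (hfin.subset fun x hx => hx.1), ← hsplit]
  rw [hres, ← hcount, hcard]
  push_cast
  rfl

theorem exists_decay_bound (hψ : ∀ q, ψ q ∈ Set.Icc (0 : ℝ) (1 / 2)) {ε : ℝ}
    (hdecay : ψ =O[atTop] fun q : ℕ => 1 / (q : ℝ) ^ ε) :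
    ∃ C₀ : ℝ, 0 ≤ C₀ ∧ ∀ q : ℕ, 0 < q → ψ q ≤ C₀ * (1 / (q : ℝ) ^ ε) := by
  obtain ⟨C, hC, hb⟩ := bound_of_isBigO_nat_atTop hdecay
  refine ⟨C, hC.le, fun q hq => ?_⟩
  have hpos : (0 : ℝ) < 1 / (q : ℝ) ^ ε := by positivity
  have := hb hpos.ne'
  rwa [Real.norm_of_nonneg (hψ q).1, Real.norm_of_nonneg hpos.le] at this

theorem ae_resonanceCount_isBigO {γ : ℝ} (hγ : Irrational γ) (hL : ¬ Liouville γ)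
    (hψ : ∀ q, ψ q ∈ Set.Icc (0 : ℝ) (1 / 2)) {ε : ℝ} (hε : 0 < ε)
    (hdiv : Tendsto (fun Q : ℕ => ∑ q ∈ Finset.Icc 1 Q, (q : ℝ) * ψ q) atTop atTop)
    (hdecay : ψ =O[atTop] fun q : ℕ => 1 / (q : ℝ) ^ ε) {δ : ℝ} (hδ : 0 < δ) :
    ∃ K : ℝ, 0 < K ∧ ∀ᵐ α : Fin 2 → UnitAddCircle,
      (fun Q : ℕ => resonanceCount ψ γ Q α - 16 * ∑ q ∈ Finset.Icc 1 Q, (q : ℝ) * ψ q) =O[atTop]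
        fun Q : ℕ => (K * ∑ q ∈ Finset.Icc 1 Q, (q : ℝ) * ψ q) ^ (1 / 2 : ℝ) *
          Real.log (K * ∑ q ∈ Finset.Icc 1 Q, (q : ℝ) * ψ q) ^ (3 / 2 + δ) := by
  obtain ⟨C₀, hC₀, hdecay'⟩ := exists_decay_bound hψ hdecay
  obtain ⟨K₀, hK₀, hvar⟩ := exists_variance_shell_le hγ hL hψ hC₀ hε hdecay'
  have hIoc : ∀ n, Finset.Icc 1 n = Finset.Ioc 0 n := fun n => rfl
  -- Adding 16 to the variance constant ensures `c = 16 / K ≤ 1` as well as the variance bound.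
  set K := K₀ + 16 with hK
  have hKpos : 0 < K := by positivity
  have hterm : ∀ h : ℕ, 0 ≤ (h : ℝ) * ψ h := fun h => mul_nonneg (Nat.cast_nonneg h) (hψ h).1
  set Φ : ℕ → ℝ := fun n => K * ∑ h ∈ Finset.Icc 1 n, (h : ℝ) * ψ h with hΦ
  have hΦsub : ∀ m n, m ≤ n → Φ n - Φ m = K * ∑ h ∈ Finset.Ioc m n, (h : ℝ) * ψ h := by
    intro m n h
    simp only [hΦ, hIoc]
    rw [← Finset.sum_Ioc_consecutive _ (Nat.zero_le m) h]
    ring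
  have hmain : ∀ n, 16 / K * Φ n = 16 * ∑ h ∈ Finset.Icc 1 n, (h : ℝ) * ψ h := fun n => by
    simp only [hΦ]; field_simp
  refine ⟨K, hKpos, ?_⟩
  have := ae_isBigO_of_variance_le (S := resonanceCount ψ γ) (μ := volume) (Φ := Φ) (c := 16 / K)
    (memLp_resonanceCount γ) (fun α => by simp [resonanceCount, shell])
    (resonanceCount_mono γ) (fun m n h => ?_) (by simp [hΦ]) (hdiv.const_mul_atTop hKpos)
    (by positivity) (by rw [div_le_one hKpos]; linarith) (fun m n h => ?_) hδ
  · simpa only [hmain] using this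
  · rw [← sub_nonneg, hΦsub m n h]
    exact mul_nonneg hKpos.le (Finset.sum_nonneg fun h _ => hterm h)
  · have e : ∀ α, resonanceCount ψ γ n α - 16 / K * Φ n -
        (resonanceCount ψ γ m α - 16 / K * Φ m) =
        ∑ q ∈ shell m n, ((approxSet ψ γ q).indicator (1 : (Fin 2 → UnitAddCircle) → ℝ) α - 2 * ψ (pairNorm q)) := by
      intro α
      have h1 := hΦsub m n h
      have h2 : 16 / K * Φ n - 16 / K * Φ m = 16 * ∑ h ∈ Finset.Ioc m n, (h : ℝ) * ψ h := by
        rw [← mul_sub, h1]; field_simp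
      rw [Finset.sum_sub_distrib, sum_shell_two_mul, ← h2, resonanceCount, resonanceCount,
        ← sum_shell_add h]
      ring
    simp_rw [e]
    rw [hΦsub m n h]
    refine (hvar m n).trans ?_
    exact mul_le_mul_of_nonneg_right (by linarith) (Finset.sum_nonneg fun h _ => hterm h)

end Counting

/-! ### Conclusion: comparison with the main term. -/

/-- The torus `𝕋²` is `Fin 2 → UnitAddCircle` with its normalized Haar measure, and the counting
function at a point `α` of it is evaluated at every representative `a ∈ ℝ²` of `α`. -/
theorem theorem2 (γ : ℝ) (hγ : Irrational γ) (hγL : ¬ Liouville γ) (ε : ℝ) (hε : 0 < ε)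
    (ψ : ℕ → ℝ) (hψ : ∀ q, ψ q ∈ Set.Icc (0 : ℝ) (1 / 2))
    (hdiv : Tendsto (fun Q : ℕ => ∑ q ∈ Finset.Icc 1 Q, (q : ℝ) * ψ q) atTop atTop)
    (hdecay : ψ =O[atTop] fun q : ℕ => 1 / (q : ℝ) ^ ε)
    (δ : ℝ) (hδ : 0 < δ) :
    ∀ᵐ α : Fin 2 → UnitAddCircle, ∀ a : Fin 2 → ℝ, (∀ i, (a i : UnitAddCircle) = α i) →
      (fun Q : ℕ => (countN ψ γ a Q : ℝ) - mainTerm ψ Q) =O[atTop]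
        fun Q : ℕ => mainTerm ψ Q ^ (1 / 2 : ℝ) * Real.log (mainTerm ψ Q) ^ (3 / 2 + δ) := by
  obtain ⟨K, hK, hae⟩ := ae_resonanceCount_isBigO hγ hγL hψ hε hdiv hdecay hδ
  have hne : ∀ᵐ α : Fin 2 → UnitAddCircle, ∀ q : ℤ × ℤ, q ≠ 0 →
      torusChar q α ≠ ((γ + 1 / 2 : ℝ) : UnitAddCircle) :=
    ae_all_iff.mpr fun q => by
      by_cases hq : q = 0
      · exact Eventually.of_forall fun α h => absurd hq h
      · filter_upwards [ae_torusChar_ne hq ((γ + 1 / 2 : ℝ) : UnitAddCircle)] with α h _ using h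
  filter_upwards [hae, hne] with α h1 h2 a ha
  set s : ℕ → ℝ := fun Q => ∑ q ∈ Finset.Icc 1 Q, (q : ℝ) * ψ q with hs
  have hψsum : ∀ Q, 0 ≤ ∑ q ∈ Finset.Icc 1 Q, ψ q := fun Q =>
    Finset.sum_nonneg fun q _ => (hψ q).1
  have hsM : ∀ Q, 16 * s Q ≤ mainTerm ψ Q := fun Q => by
    rw [mainTerm]; linarith [hψsum Q]
  have hlarge : ∀ᶠ Q in atTop, Real.exp 1 ≤ s Q ∧ Real.exp 1 ≤ K * s Q ∧ K ≤ s Q :=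
    (hdiv.eventually_ge_atTop _).and (((hdiv.const_mul_atTop hK).eventually_ge_atTop _).and
      (hdiv.eventually_ge_atTop _))
  set G : ℕ → ℝ := fun Q => mainTerm ψ Q ^ (1 / 2 : ℝ) * Real.log (mainTerm ψ Q) ^ (3 / 2 + δ)
    with hG
  have hlogM : ∀ᶠ Q in atTop, 1 ≤ Real.log (mainTerm ψ Q) ∧ 1 ≤ mainTerm ψ Q := by
    filter_upwards [hlarge] with Q ⟨hQ, _⟩
    have h3 : (1 : ℝ) ≤ Real.exp 1 := Real.one_le_exp zero_le_one
    have h4 := hsM Q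
    exact ⟨(Real.le_log_iff_exp_le (by linarith)).mpr (by linarith), by linarith⟩
  have hmainO : (fun Q : ℕ => (K * s Q) ^ (1 / 2 : ℝ) * Real.log (K * s Q) ^ (3 / 2 + δ))
      =O[atTop] G := by
    refine IsBigO.of_bound (K ^ (1 / 2 : ℝ) * 2 ^ (3 / 2 + δ)) ?_
    filter_upwards [hlarge, hlogM] with Q ⟨hQ1, hQ2, hQ3⟩ ⟨hl, hm⟩
    have hexp : (1 : ℝ) ≤ Real.exp 1 := Real.one_le_exp zero_le_one
    have h4 := hsM Q
    have hsle : s Q ≤ mainTerm ψ Q := by linarith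
    have hlog0 : 0 ≤ Real.log (K * s Q) := Real.log_nonneg (by linarith)
    -- Eventually `K ≤ s Q`, so the constant `K` inside the logarithm costs only a factor 2.
    have hlog : Real.log (K * s Q) ≤ 2 * Real.log (mainTerm ψ Q) := by
      rw [Real.log_mul hK.ne' (by linarith)]
      have := Real.log_le_log hK (hQ3.trans hsle)
      have := Real.log_le_log (by linarith) hsle
      linarith
    rw [Real.norm_of_nonneg (mul_nonneg (Real.rpow_nonneg (by linarith) _)
        (Real.rpow_nonneg hlog0 _)),
      Real.norm_of_nonneg (mul_nonneg (Real.rpow_nonneg (by linarith) _)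
        (Real.rpow_nonneg (by linarith) _))]
    calc (K * s Q) ^ (1 / 2 : ℝ) * Real.log (K * s Q) ^ (3 / 2 + δ)
        ≤ (K * mainTerm ψ Q) ^ (1 / 2 : ℝ) * (2 * Real.log (mainTerm ψ Q)) ^ (3 / 2 + δ) := by
          have : 0 ≤ K * s Q := by linarith
          gcongr
      _ = _ := by
          rw [Real.mul_rpow hK.le (by linarith), Real.mul_rpow (by norm_num) (by linarith)]
          ring
  have hrest : (fun Q : ℕ => (countN ψ γ a 0 : ℝ) - 8 * ∑ q ∈ Finset.Icc 1 Q, ψ q)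
      =O[atTop] G := by
    refine IsBigO.of_bound ((countN ψ γ a 0 : ℝ) + 8) ?_
    filter_upwards [hlogM, hlarge] with Q ⟨hl, hm⟩ ⟨hQ1, _⟩
    have hexp : (1 : ℝ) ≤ Real.exp 1 := Real.one_le_exp zero_le_one
    have h4 := hsM Q
    have h5 : ∑ q ∈ Finset.Icc 1 Q, ψ q ≤ mainTerm ψ Q ^ (1 / 2 : ℝ) := by
      rw [← Real.sqrt_eq_rpow]
      refine Real.le_sqrt_of_sq_le ((sq_sum_le_sum_mul hψ Q).trans ?_)
      simp only [hs] at h4 hQ1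
      linarith
    have h6 : (1 : ℝ) ≤ mainTerm ψ Q ^ (1 / 2 : ℝ) := Real.one_le_rpow hm (by norm_num)
    have h7 : 1 ≤ Real.log (mainTerm ψ Q) ^ (3 / 2 + δ) := Real.one_le_rpow hl (by positivity)
    have h8 : mainTerm ψ Q ^ (1 / 2 : ℝ) ≤ G Q := by
      simp only [hG]
      exact le_mul_of_one_le_right (by linarith) h7
    have h9 : (0 : ℝ) ≤ countN ψ γ a 0 := Nat.cast_nonneg _
    have h10 := hψsum Q
    rw [Real.norm_eq_abs, Real.norm_of_nonneg (by linarith), abs_le]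
    constructor <;> nlinarith [mul_nonneg h9 (by linarith : 0 ≤ G Q - 1)]
  refine ((h1.trans hmainO).add hrest).congr_left fun Q => ?_
  rw [countN_eq hψ ha h2 Q, mainTerm]
  ring
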